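/- For complex numbers $x,q$ with $|q|<1$ put $(x;q)_n=\prod_{k=0}^{n-1}(1-xq^k)$, $(x;q)_\infty=\prod_{k\ge 0}(1-xq^k)$, $(x,y;q)_\infty=(x;q)_\infty(y;q)_\infty$, and ${n\brack k}_q=\frac{(q;q)_n}{(q;q)_k(q;q)_{n-k}}$ for $0\le k\le n$, ${n\brack k}_q=0$ otherwise ($0^0=1$). For $|p|,|q|,|a|,|t|<1$ let $$H_{p,q}(a,t)=\frac{(q^2;q^2)_\infty(at;p)_\infty(pt^2;p^2)_\infty}{2\pi}\int_0^\pi\frac{(e^{2i\theta},e^{-2i\theta};q^2)_\infty}{(ae^{i\theta},ae^{-i\theta};q^2)_\infty\,(te^{i\theta},te^{-i\theta};p)_\infty}\,d\theta .$$ Further let, for $0\le 2k\le n$, $$c_{n,n-2k}(p,q)=\sum_{j=0}^k(-1)^jp^{k-j}q^{\binom{j+1}{2}}{n-2k+j\brack j}_q\left({n\brack k-j}_p-p^{n-2k+2j+1}{n\brack k-j-1}_p\right),$$ $$d_{n,j,l,m}(p,q)={n\brack j}_p(-1)^jp^{\binom j2}a^{j}{n-j-2l\brack m}_q c_{n-j,\,n-j-2l}(p,q)\,a^m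 .$$ Then for all complex $p,q,a,t$ of modulus less than $1$, $$H_{p,q}(a,t)=\sum_{n=0}^\infty\left(\sum_{k=0}^n\frac{(-1)^kp^{k^2}a^kt^{n+k}}{(p^2;p^2)_k(p;p)_{n-k}}\right)\left(\sum_{j=0}^n\ \sum_{l=0}^{\lfloor (n-j)/2\rfloor}d_{n,j,l,n-j-2l}(p^2,q^2)\right),$$ the sum over $n$ being absolutely convergent. Moreover, for all complex $q,a,t$ of modulus less than $1$, both this integral and this series have, at the indicated bases, the values $$H_{q,q}(a,t)=1,\qquad H_{-q,q}(a,t)=1,\qquad H_{q^2,q}(a,t)=(q^2t^2;q^4)_\infty,\qquad H_{q^2,q^3}(a,t)=\frac{(at^3q^6;q^6)_\infty}{(t^2q^4;q^4)_\infty}.$$ -/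

import Mathlib

open scoped BigOperators

noncomputable section

namespace BigQHermite

/-- The finite `q`-shifted factorial `(a;q)_n`. -/
def qPoch (a q : ℂ) (n : ℕ) : ℂ := ∏ k ∈ Finset.range n, (1 - a * q ^ k)

/-- The infinite `q`-shifted factorial `(a;q)_∞`; the product converges for `|q| < 1`. -/
def qPochInf (a q : ℂ) : ℂ := ∏' k : ℕ, (1 - a * q ^ k)

/-- The Gaussian coefficient `[n, k]_q = (q;q)_n / ((q;q)_k (q;q)_{n-k})`, zero for `k > n`. -/
def qBinom (q : ℂ) (n k : ℕ) : ℂ :=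
  if k ≤ n then qPoch q q n / (qPoch q q k * qPoch q q (n - k)) else 0

/-- The integrand of `H_{p,q}(a,t)`:
`(e^{2iθ}, e^{-2iθ}; q²)_∞ / ((a e^{iθ}, a e^{-iθ}; q²)_∞ (t e^{iθ}, t e^{-iθ}; p)_∞)`. -/
def hIntegrand (p q a t : ℂ) (θ : ℝ) : ℂ :=
  (qPochInf (Complex.exp (2 * Complex.I * θ)) (q ^ 2) *
      qPochInf (Complex.exp (-(2 * Complex.I * θ))) (q ^ 2)) /
    ((qPochInf (a * Complex.exp (Complex.I * θ)) (q ^ 2) *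
        qPochInf (a * Complex.exp (-(Complex.I * θ))) (q ^ 2)) *
      (qPochInf (t * Complex.exp (Complex.I * θ)) p *
        qPochInf (t * Complex.exp (-(Complex.I * θ))) p))

/-- The integral `H_{p,q}(a,t)`. -/
def hIntegral (p q a t : ℂ) : ℂ :=
  qPochInf (q ^ 2) (q ^ 2) * qPochInf (a * t) p * qPochInf (p * t ^ 2) (p ^ 2) /
      (2 * (Real.pi : ℂ)) *
    ∫ θ in (0 : ℝ)..Real.pi, hIntegrand p q a t θ

/-- The `q`-Hermite change of base coefficient `c_{n,n-2k}(p,q)` (for `2k ≤ n`):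
`∑_{j=0}^k (-1)^j p^{k-j} q^{(j+1 choose 2)} [n-2k+j, j]_q
  ([n, k-j]_p - p^{n-2k+2j+1} [n, k-j-1]_p)`, where `[n, -1]_p = 0`. -/
def cCoeff (p q : ℂ) (n k : ℕ) : ℂ :=
  ∑ j ∈ Finset.range (k + 1),
    (-1) ^ j * p ^ (k - j) * q ^ ((j + 1).choose 2) * qBinom q (n - 2 * k + j) j *
      (qBinom p n (k - j) -
        if j < k then p ^ (n - 2 * k + 2 * j + 1) * qBinom p n (k - j - 1) else 0)

/-- The change of base coefficient
`d_{n,j,l,m}(p,q) = [n, j]_p (-1)^j p^{(j choose 2)} a^j [n-j-2l, m]_q c_{n-j,n-j-2l}(p,q) a^m`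
multiplying `H_{n-j-2l-m}(x;a|q)` in the expansion of `H_n(x;a|p)`, where
`0 ≤ j ≤ n`, `0 ≤ 2l ≤ n - j` and `0 ≤ m ≤ n - j - 2l`. -/
def dCoeff (p q a : ℂ) (n j l m : ℕ) : ℂ :=
  qBinom p n j * (-1) ^ j * p ^ (j.choose 2) * a ^ j *
    (qBinom q (n - j - 2 * l) m * cCoeff p q (n - j) l * a ^ m)

/-- The total coefficient of `H_0(x;a|q)` in the expansion of `H_n(x;a|p)`:
`∑_{j=0}^n ∑_{l=0}^{⌊(n-j)/2⌋} d_{n,j,l,n-j-2l}(p,q)`. -/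
def dZero (p q a : ℂ) (n : ℕ) : ℂ :=
  ∑ j ∈ Finset.range (n + 1), ∑ l ∈ Finset.range ((n - j) / 2 + 1),
    dCoeff p q a n j l (n - j - 2 * l)

/-- The `n`-th term of the series for `H_{p,q}(a,t)`:
`∑_{k=0}^n (-1)^k p^{k²} a^k t^{n+k} / ((p²;p²)_k (p;p)_{n-k})` times the coefficient of
`H_0(x;a|q²)` in `H_n(x;a|p²)`. -/
def hTerm (p q a t : ℂ) (n : ℕ) : ℂ :=
  (∑ k ∈ Finset.range (n + 1),
      (-1) ^ k * p ^ (k ^ 2) * a ^ k * t ^ (n + k) /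
        (qPoch (p ^ 2) (p ^ 2) k * qPoch p p (n - k))) *
    dZero (p ^ 2) (q ^ 2) a n

end BigQHermite

end

/-! Up to the prefactor (at;p)_∞(pt²;p²)_∞, the integral is the normalized q²-Hermite functional L
applied to G_{q²}(a) G_p(t), where G_q(c) = 1/(ce^{iθ}, ce^{-iθ};q)_∞ (`hIntegral_eq`).

For the series, the prefactor times G_p(t) is expanded in continuous big p²-Hermite polynomials
(`hasSum_expandCoeff`) and integrated term by term. Each term is L(H_n(·;a|p²) G_{q²}(a)). A big
polynomial is a combination of p²-Hermite polynomials, the change of base formula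
`rogersSzego_change_base` rewrites these in base q², and L(H_N G(a)) = a^N; this reproduces `dZero`
(`dZero_eq_hermiteFun`).

For the closed forms, G_p(t) factors into kernels whose base is that of L, and the Askey–Wilson
integral `hermiteFun_askeyWilson` applies. That integral is obtained by using the q-Mehler formula
`hasSum_qMehler` twice, on either side of the orthogonality relation `hermiteFun_hermite_mul`.

Two devices recur. Product formulas come from first-order q-difference equations, iterated to the
limit (`mul_qPochInf_eq_of_qdiff`). Orthogonality rests on the Fourier coefficients of a theta
product, computed from Euler's expansion and Cauchy's series for 1/(q;q)_∞, and passes to Hermite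
polynomials through Chebyshev polynomials. -/

namespace BigQHermite

open Filter Topology Finset MeasureTheory
open Complex (I)

/-! ### Finite and infinite q-shifted factorials. -/

section QPochhammer

variable {q : ℂ}

lemma qPoch_succ (a q : ℂ) (n : ℕ) : qPoch a q (n + 1) = qPoch a q n * (1 - a * q ^ n) :=
  prod_range_succ _ _

@[simp] lemma qPoch_zero (a q : ℂ) : qPoch a q 0 = 1 := prod_range_zero _

@[simp] lemma qPochInf_zero (q : ℂ) : qPochInf 0 q = 1 := by simp [qPochInf]

lemma summable_norm_mul_pow (hq : ‖q‖ < 1) (a : ℂ) : Summable fun k : ℕ => ‖-(a * q ^ k)‖ := by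
  simpa [norm_mul, norm_pow] using
    (summable_geometric_of_lt_one (norm_nonneg q) hq).mul_left ‖a‖

lemma tendsto_qPoch (hq : ‖q‖ < 1) (a : ℂ) :
    Tendsto (qPoch a q) atTop (𝓝 (qPochInf a q)) := by
  have h := (multipliable_one_add_of_summable (summable_norm_mul_pow hq a)).hasProd.tendsto_prod_nat
  simp only [← sub_eq_add_neg] at h
  exact h

lemma one_sub_ne_zero_of_norm_lt {x : ℂ} (hx : ‖x‖ < 1) : 1 - x ≠ 0 := by
  rintro h
  rw [← sub_eq_zero.mp h] at hx
  simp at hx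

lemma norm_mul_pow_lt (hq : ‖q‖ < 1) {a : ℂ} (ha : ‖a‖ < 1) (k : ℕ) : ‖a * q ^ k‖ < 1 := by
  rw [norm_mul, norm_pow]
  exact mul_lt_one_of_nonneg_of_lt_one_left (norm_nonneg _) ha
    (pow_le_one₀ (norm_nonneg _) hq.le)

lemma norm_pow_lt_one (hq : ‖q‖ < 1) {n : ℕ} (hn : n ≠ 0) : ‖q ^ n‖ < 1 := by
  rw [norm_pow]
  exact pow_lt_one₀ (norm_nonneg _) hq hn

lemma qPochInf_ne_zero (hq : ‖q‖ < 1) {a : ℂ} (ha : ‖a‖ < 1) : qPochInf a q ≠ 0 := by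
  have := tprod_one_add_ne_zero_of_summable (f := fun k : ℕ => -(a * q ^ k))
    (fun k => by
      rw [← sub_eq_add_neg]
      exact one_sub_ne_zero_of_norm_lt (norm_mul_pow_lt hq ha k))
    (summable_norm_mul_pow hq a)
  simpa [qPochInf, ← sub_eq_add_neg] using this

lemma qPoch_ne_zero (hq : ‖q‖ < 1) {a : ℂ} (ha : ‖a‖ < 1) (n : ℕ) : qPoch a q n ≠ 0 :=
  prod_ne_zero_iff.mpr fun k _ => one_sub_ne_zero_of_norm_lt (norm_mul_pow_lt hq ha k)

lemma continuous_qPochInf (hq : ‖q‖ < 1) : Continuous fun a => qPochInf a q := by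
  refine continuous_iff_continuousAt.mpr fun a => ?_
  have h := tendsto_tprod_one_add_of_dominated_convergence (𝓕 := 𝓝 a)
    (f := fun (x : ℂ) (k : ℕ) => -(x * q ^ k)) (g := fun k => -(a * q ^ k))
    (bound := fun k => (‖a‖ + 1) * ‖q‖ ^ k)
    ((summable_geometric_of_lt_one (norm_nonneg q) hq).mul_left _)
    (fun k => (Continuous.tendsto (by fun_prop) a))
    (by
      filter_upwards [Metric.ball_mem_nhds a one_pos] with x hx k
      rw [norm_neg, norm_mul, norm_pow]
      gcongr
      have h1 : ‖x - a‖ < 1 := by simpa [dist_eq_norm] using hx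
      have h2 : ‖x‖ ≤ ‖a‖ + ‖x - a‖ := by simpa using norm_add_le a (x - a)
      linarith)
  simpa only [ContinuousAt, qPochInf, sub_eq_add_neg] using h

lemma qPochInf_eq (hq : ‖q‖ < 1) (a : ℂ) : qPochInf a q = (1 - a) * qPochInf (a * q) q := by
  refine tendsto_nhds_unique ((tendsto_qPoch hq a).comp (tendsto_add_atTop_nat 1)) ?_
  refine ((tendsto_qPoch hq (a * q)).const_mul (1 - a)).congr fun n => ?_
  simp only [Function.comp, qPoch, prod_range_succ', pow_zero, mul_one, pow_succ']
  rw [mul_comm]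
  congr 1
  exact prod_congr rfl fun k _ => by ring

lemma qPochInf_sq (hq : ‖q‖ < 1) (a : ℂ) :
    qPochInf a q = qPochInf a (q ^ 2) * qPochInf (a * q) (q ^ 2) := by
  have hq2 := norm_pow_lt_one hq two_ne_zero
  refine tendsto_nhds_unique ((tendsto_qPoch hq a).comp
    (tendsto_id.const_mul_atTop' (r := 2) two_pos)) ?_
  refine ((tendsto_qPoch hq2 a).mul (tendsto_qPoch hq2 (a * q))).congr fun n => ?_
  simp only [Function.comp, id]
  induction n with
  | zero => simp
  | succ n ih => rw [show 2 * (n + 1) = 2 * n + 1 + 1 by ring, qPoch_succ _ _ (2 * n + 1), qPoch_succ _ _ (2 * n), ← ih,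
      qPoch_succ, qPoch_succ]; ring

lemma qPochInf_cube (hq : ‖q‖ < 1) (a : ℂ) :
    qPochInf a q =
      qPochInf a (q ^ 3) * qPochInf (a * q) (q ^ 3) * qPochInf (a * q ^ 2) (q ^ 3) := by
  have hq3 := norm_pow_lt_one hq three_ne_zero
  refine tendsto_nhds_unique ((tendsto_qPoch hq a).comp
    (tendsto_id.const_mul_atTop' (r := 3) three_pos)) ?_
  refine (((tendsto_qPoch hq3 a).mul (tendsto_qPoch hq3 (a * q))).mul
    (tendsto_qPoch hq3 (a * q ^ 2))).congr fun n => ?_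
  simp only [Function.comp, id]
  induction n with
  | zero => simp
  | succ n ih => rw [show 3 * (n + 1) = 3 * n + 2 + 1 by ring, qPoch_succ _ _ (3 * n + 2), qPoch_succ _ _ (3 * n + 1),
      qPoch_succ _ _ (3 * n), ← ih, qPoch_succ, qPoch_succ, qPoch_succ]; ring

/-- A first-order `q`-difference equation is solved by infinite products. -/
lemma mul_qPochInf_eq_of_qdiff (hq : ‖q‖ < 1) {u v c G : ℂ} {f g : ℕ → ℂ}
    (hf : Tendsto f atTop (𝓝 c))
    (hg : Tendsto (fun N => ∏ k ∈ range N, g k) atTop (𝓝 G))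
    (h : ∀ N, f N * ((1 - u * q ^ N) * (1 - v * q ^ N)) = f (N + 1) * g N) :
    f 0 * (qPochInf u q * qPochInf v q) = c * G := by
  refine tendsto_nhds_unique
    (((tendsto_qPoch hq u).mul (tendsto_qPoch hq v)).const_mul (f 0)) ?_
  -- Iterating `h` gives f 0 · (u;q)_n (v;q)_n = f n · ∏_{k<n} g k, and both sides converge.
  refine (hf.mul hg).congr fun n => ?_
  induction n with
  | zero => simp
  | succ n ih =>
    rw [prod_range_succ, qPoch_succ, qPoch_succ]
    linear_combination (-∏ k ∈ range n, g k) * h n +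
      (1 - u * q ^ n) * (1 - v * q ^ n) * ih

/-- The sequence (q;q)_n has a nonzero limit, so it and its inverse are both bounded. The majorants
for the later series are built on this. -/
lemma exists_qPoch_bound (hq : ‖q‖ < 1) :
    ∃ C : ℝ, 1 ≤ C ∧ (∀ n, ‖qPoch q q n‖ ≤ C) ∧ ∀ n, ‖(qPoch q q n)⁻¹‖ ≤ C := by
  obtain ⟨A, hA⟩ := (tendsto_qPoch hq q).norm.bddAbove_range
  obtain ⟨B, hB⟩ := ((tendsto_qPoch hq q).inv₀ (qPochInf_ne_zero hq hq)).norm.bddAbove_range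
  refine ⟨max 1 (max A B), le_max_left _ _, fun n => ?_, fun n => ?_⟩
  · exact (hA ⟨n, rfl⟩).trans ((le_max_left _ _).trans (le_max_right _ _))
  · exact (hB ⟨n, rfl⟩).trans ((le_max_right _ _).trans (le_max_right _ _))

end QPochhammer

/-! ### Gaussian coefficients and the two q-Pascal rules. -/

section QBinomial

variable {q : ℂ}

lemma qBinom_of_lt {n k : ℕ} (h : n < k) : qBinom q n k = 0 := by simp [qBinom, h]

lemma qBinom_add (q : ℂ) (k m : ℕ) :
    qBinom q (k + m) k = qPoch q q (k + m) / (qPoch q q k * qPoch q q m) := by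
  simp [qBinom]

lemma qBinom_zero_right (hq : ‖q‖ < 1) (n : ℕ) : qBinom q n 0 = 1 := by
  simp [qBinom, div_self (qPoch_ne_zero hq hq n)]

lemma qBinom_self (hq : ‖q‖ < 1) (n : ℕ) : qBinom q n n = 1 := by
  simp [qBinom, div_self (qPoch_ne_zero hq hq n)]

lemma qBinom_symm {n k : ℕ} (h : k ≤ n) : qBinom q n (n - k) = qBinom q n k := by
  obtain ⟨m, rfl⟩ := Nat.exists_eq_add_of_le h
  simp [qBinom, mul_comm]

lemma qBinom_succ_mul (hq : ‖q‖ < 1) (n k : ℕ) :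
    qBinom q (n + 1) (k + 1) * (1 - q ^ (k + 1)) = (1 - q ^ (n + 1)) * qBinom q n k := by
  rcases lt_or_ge n k with h | h
  · simp [qBinom_of_lt h, qBinom_of_lt (Nat.succ_lt_succ h)]
  obtain ⟨m, rfl⟩ := Nat.exists_eq_add_of_le h
  rw [show k + m + 1 = k + 1 + m by ring, qBinom_add, qBinom_add,
    show k + 1 + m = k + m + 1 by ring, qPoch_succ, qPoch_succ, ← pow_succ', ← pow_succ']
  have h1 := qPoch_ne_zero hq hq k
  have h2 := qPoch_ne_zero hq hq m
  have h3 := one_sub_ne_zero_of_norm_lt (norm_pow_lt_one hq k.succ_ne_zero)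
  field_simp

/-- No hypothesis `k < n` is needed: for `n ≤ k` truncated subtraction makes the factor 1 - q^0 = 0,
and the left side vanishes too. -/
lemma qBinom_mul_sub (hq : ‖q‖ < 1) (n k : ℕ) :
    qBinom q n (k + 1) * (1 - q ^ (k + 1)) = (1 - q ^ (n - k)) * qBinom q n k := by
  rcases le_or_gt n k with h | h
  · simp [qBinom_of_lt (Nat.lt_succ_of_le h), Nat.sub_eq_zero_of_le h]
  obtain ⟨m, rfl⟩ := Nat.exists_eq_add_of_lt h
  rw [show k + m + 1 - k = m + 1 by omega, show k + m + 1 = k + 1 + m by ring, qBinom_add,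
    show k + 1 + m = k + (m + 1) by ring, qBinom_add, qPoch_succ _ _ m, qPoch_succ _ _ k,
    ← pow_succ', ← pow_succ']
  have h1 := qPoch_ne_zero hq hq k
  have h2 := qPoch_ne_zero hq hq m
  have h3 := one_sub_ne_zero_of_norm_lt (norm_pow_lt_one hq k.succ_ne_zero)
  have h4 := one_sub_ne_zero_of_norm_lt (norm_pow_lt_one hq m.succ_ne_zero)
  field_simp

lemma qBinom_succ_succ (hq : ‖q‖ < 1) (n k : ℕ) :
    qBinom q (n + 1) (k + 1) = qBinom q n k + q ^ (k + 1) * qBinom q n (k + 1) := by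
  rcases lt_or_ge n k with h | h
  · simp [qBinom_of_lt h, qBinom_of_lt (Nat.succ_lt_succ h), qBinom_of_lt (h.trans k.lt_succ_self)]
  have h3 : 1 - q ^ (k + 1) ≠ 0 :=
    one_sub_ne_zero_of_norm_lt (norm_pow_lt_one hq k.succ_ne_zero)
  have e : q ^ (n + 1) = q ^ (k + 1) * q ^ (n - k) := by
    rw [← pow_add]; congr 1; omega
  apply mul_right_cancel₀ h3
  linear_combination qBinom_succ_mul hq n k - q ^ (k + 1) * qBinom_mul_sub hq n k -
    qBinom q n k * e

lemma qBinom_succ_succ' (hq : ‖q‖ < 1) (n k : ℕ) :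
    qBinom q (n + 1) (k + 1) = q ^ (n - k) * qBinom q n k + qBinom q n (k + 1) := by
  rcases lt_or_ge n k with h | h
  · simp [qBinom_of_lt h, qBinom_of_lt (Nat.succ_lt_succ h), qBinom_of_lt (h.trans k.lt_succ_self)]
  linear_combination qBinom_succ_succ hq n k - qBinom_mul_sub hq n k

lemma exists_qBinom_bound (hq : ‖q‖ < 1) : ∃ C : ℝ, 1 ≤ C ∧ ∀ n k, ‖qBinom q n k‖ ≤ C := by
  obtain ⟨C, h1, hC, hC'⟩ := exists_qPoch_bound hq
  refine ⟨C * (C * C), one_le_mul_of_one_le_of_one_le h1 (one_le_mul_of_one_le_of_one_le h1 h1),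
    fun n k => ?_⟩
  unfold qBinom
  split_ifs
  · rw [div_eq_mul_inv, mul_inv, norm_mul, norm_mul]
    gcongr
    exacts [hC _, hC' _, hC' _]
  · simp; positivity

end QBinomial

/-! ### Rogers–Szegő polynomials and their three-term recurrence. -/

section RogersSzego

variable {q : ℂ}

/-- The homogeneous Rogers–Szegő polynomial; `rogersSzego q e^{iθ} e^{-iθ} n` is the continuous
`q`-Hermite polynomial `H_n(cos θ | q)`. -/
noncomputable def rogersSzego (q u v : ℂ) (n : ℕ) : ℂ :=
  ∑ k ∈ range (n + 1), qBinom q n k * u ^ k * v ^ (n - k)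

@[simp] lemma rogersSzego_zero (q u v : ℂ) : rogersSzego q u v 0 = 1 := by
  simp [rogersSzego, qBinom]

lemma rogersSzego_succ_eq_dilate (hq : ‖q‖ < 1) (u v : ℂ) (n : ℕ) :
    rogersSzego q u v (n + 1) = u * rogersSzego q u v n + v * rogersSzego q (q * u) v n := by
  have e : v * rogersSzego q (q * u) v n =
      (∑ k ∈ range (n + 1), q ^ (k + 1) * qBinom q n (k + 1) * u ^ (k + 1) * v ^ (n - k)) +
        v ^ (n + 1) := by
    rw [sum_range_succ _ n, qBinom_of_lt n.lt_succ_self, rogersSzego, sum_range_succ', mul_add,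
      mul_sum]
    simp only [mul_zero, zero_mul, add_zero, pow_zero, mul_one, Nat.sub_zero,
      qBinom_zero_right hq, one_mul, ← pow_succ']
    congr 1
    refine sum_congr rfl fun k hk => ?_
    rw [show n - k = n - (k + 1) + 1 by have := mem_range.mp hk; omega]
    ring
  rw [e, rogersSzego, sum_range_succ', rogersSzego, mul_sum, ← add_assoc, ← sum_add_distrib]
  simp only [pow_zero, mul_one, Nat.sub_zero, qBinom_zero_right hq, one_mul]
  congr 1
  refine sum_congr rfl fun k _ => ?_
  rw [qBinom_succ_succ hq, Nat.add_sub_add_right]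
  ring

lemma rogersSzego_sub_dilate (hq : ‖q‖ < 1) (u v : ℂ) (n : ℕ) :
    rogersSzego q u v n - rogersSzego q (q * u) v n =
      u * (1 - q ^ n) * rogersSzego q u v (n - 1) := by
  cases n with
  | zero => simp
  | succ n =>
    rw [Nat.add_sub_cancel, rogersSzego, rogersSzego, sum_range_succ', sum_range_succ' _ (n + 1),
      rogersSzego, mul_sum]
    simp only [pow_zero, add_sub_add_right_eq_sub, ← sum_sub_distrib]
    refine sum_congr rfl fun k _ => ?_
    rw [Nat.add_sub_add_right]
    linear_combination u ^ (k + 1) * v ^ (n - k) * qBinom_succ_mul hq n k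

/-- The q-Pascal rule yields a recurrence that involves the dilation u ↦ qu; the dilated polynomial
is eliminated with `rogersSzego_sub_dilate`. -/
lemma rogersSzego_succ (hq : ‖q‖ < 1) (u v : ℂ) (n : ℕ) :
    rogersSzego q u v (n + 1) =
      (u + v) * rogersSzego q u v n - u * v * (1 - q ^ n) * rogersSzego q u v (n - 1) := by
  linear_combination rogersSzego_succ_eq_dilate hq u v n - v * rogersSzego_sub_dilate hq u v n

lemma rogersSzego_one (hq : ‖q‖ < 1) (u v : ℂ) : rogersSzego q u v 1 = u + v := by
  simpa using rogersSzego_succ hq u v 0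

lemma exists_rogersSzego_bound_pow (hq : ‖q‖ < 1) :
    ∃ C : ℝ, 1 ≤ C ∧ ∀ (u v : ℂ) (r : ℝ), ‖u‖ ≤ r → ‖v‖ ≤ r → ∀ n,
      ‖rogersSzego q u v n‖ ≤ C * ((n + 1) * r ^ n) := by
  obtain ⟨C, h1, hC⟩ := exists_qBinom_bound hq
  refine ⟨C, h1, fun u v r hu hv n => ?_⟩
  calc ‖rogersSzego q u v n‖ ≤ ∑ k ∈ range (n + 1), C * r ^ n := by
        refine norm_sum_le_of_le _ fun k hk => ?_
        have hk' := mem_range.mp hk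
        have hr : 0 ≤ r := (norm_nonneg u).trans hu
        rw [norm_mul, norm_mul, norm_pow, norm_pow]
        calc _ ≤ C * r ^ k * r ^ (n - k) := by gcongr; exact hC n k
          _ = C * r ^ n := by rw [mul_assoc, ← pow_add, show k + (n - k) = n by omega]
    _ = C * ((n + 1) * r ^ n) := by simp; ring

lemma exists_rogersSzego_bound (hq : ‖q‖ < 1) :
    ∃ C : ℝ, 1 ≤ C ∧ ∀ u v : ℂ, ‖u‖ ≤ 1 → ‖v‖ ≤ 1 → ∀ n,
      ‖rogersSzego q u v n‖ ≤ C * (n + 1) := by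
  obtain ⟨C, h1, hC⟩ := exists_rogersSzego_bound_pow hq
  exact ⟨C, h1, fun u v hu hv n => by simpa using hC u v 1 hu hv n⟩

lemma rogersSzego_div (hq : ‖q‖ < 1) (a b : ℂ) (n : ℕ) :
    rogersSzego q a b n / qPoch q q n =
      ∑ ij ∈ antidiagonal n, a ^ ij.1 / qPoch q q ij.1 * (b ^ ij.2 / qPoch q q ij.2) := by
  rw [Nat.sum_antidiagonal_eq_sum_range_succ_mk, rogersSzego, sum_div]
  refine sum_congr rfl fun k hk => ?_
  have := qPoch_ne_zero hq hq n
  rw [qBinom, if_pos (Nat.lt_succ_iff.mp (mem_range.mp hk))]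
  field_simp

end RogersSzego

/-! ### Generating functions and the q-Mehler formula. -/

section GeneratingFunctions

variable {q : ℂ}

lemma hasSum_succ_iff {x : ℕ → ℂ} {S : ℂ} (h0 : x 0 = 0) :
    HasSum (fun j => x (j + 1)) S ↔ HasSum x S := by
  simpa [h0] using hasSum_nat_add_iff' (f := x) (g := S) 1

lemma summable_div_qPoch (hq : ‖q‖ < 1) {x : ℕ → ℂ} (hx : Summable fun j => ‖x j‖) :
    Summable fun j => ‖x j / qPoch q q j‖ := by
  obtain ⟨C, h1, -, hC⟩ := exists_qPoch_bound hq
  refine Summable.of_nonneg_of_le (fun _ => norm_nonneg _) (fun j => ?_) (hx.mul_right C)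
  rw [div_eq_mul_inv, norm_mul]
  gcongr
  exact hC j

/-- A three-term recurrence of `q`-Hermite type gives a product formula for the generating
function. -/
lemma hasSum_of_qHermite_rec (hq : ‖q‖ < 1) {u v r b : ℂ} {g : ℕ → ℂ}
    (hrec : ∀ j, g (j + 1) = (u + v - r * q ^ j) * g j - u * v * (1 - q ^ j) * g (j - 1))
    (hsum : Summable fun j => ‖g j * b ^ j‖) (hu : ‖u * b‖ < 1) (hv : ‖v * b‖ < 1) :
    HasSum (fun j => g j * b ^ j / qPoch q q j)
      (g 0 * qPochInf (r * b) q / (qPochInf (u * b) q * qPochInf (v * b) q)) := by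
  have hS := summable_div_qPoch hq hsum
  have hle : ∀ N j : ℕ, ‖(q ^ N) ^ j‖ ≤ 1 := fun N j => by
    rw [← pow_mul, norm_pow]; exact pow_le_one₀ (norm_nonneg _) hq.le
  have hSN : ∀ N : ℕ, Summable fun j => g j * (b * q ^ N) ^ j / qPoch q q j := fun N => by
    refine Summable.of_norm_bounded hS fun j => ?_
    rw [mul_pow, ← mul_assoc, mul_div_right_comm, norm_mul]
    exact mul_le_of_le_one_right (norm_nonneg _) (hle N j)
  set Φ : ℕ → ℂ := fun N => ∑' j, g j * (b * q ^ N) ^ j / qPoch q q j with hΦ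
  have hlim : Tendsto Φ atTop (𝓝 (g 0)) := by
    have h := tendsto_tsum_of_dominated_convergence (𝓕 := atTop)
      (f := fun (N j : ℕ) => g j * (b * q ^ N) ^ j / qPoch q q j)
      (g := fun j => if j = 0 then g 0 else 0) hS (fun j => ?_)
      (Eventually.of_forall fun N j => ?_)
    · simpa using h
    · rcases eq_or_ne j 0 with rfl | hj
      · simp
      · have : Tendsto (fun N : ℕ => b * q ^ N) atTop (𝓝 (b * 0)) :=
          (tendsto_pow_atTop_nhds_zero_of_norm_lt_one hq).const_mul b
        simpa [hj] using ((this.pow j).const_mul (g j)).div_const (qPoch q q j)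
    · rw [mul_pow, ← mul_assoc, mul_div_right_comm, norm_mul]
      exact mul_le_of_le_one_right (norm_nonneg _) (hle N j)
  -- With F(s) = ∑ g_j s^j/(q;q)_j, the difference F(s) - F(qs) is ∑ g_{j+1} s^{j+1}/(q;q)_j.
  -- Inserting the recurrence gives F(s)(1-us)(1-vs) = F(qs)(1-rs).
  have hfun : ∀ N, Φ N * ((1 - u * b * q ^ N) * (1 - v * b * q ^ N)) =
      Φ (N + 1) * (1 - r * b * q ^ N) := fun N => by
    set s := b * q ^ N with hs
    have h1 : HasSum (fun j => g j * s ^ j / qPoch q q j) (Φ N) := (hSN N).hasSum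
    have h2 : HasSum (fun j => g j * s ^ j / qPoch q q j * q ^ j) (Φ (N + 1)) := by
      refine (hSN (N + 1)).hasSum.congr_fun fun j => ?_
      rw [hs]; ring
    have h3 := (hasSum_succ_iff (by simp)).mpr (h1.sub h2)
    have h4 : HasSum (fun j => g (j - 1) * s ^ j / qPoch q q j * (1 - q ^ j)) (s * Φ N) := by
      refine (hasSum_succ_iff (by simp)).mp ((h1.mul_left s).congr_fun fun j => ?_)
      have h5 := one_sub_ne_zero_of_norm_lt (norm_mul_pow_lt hq hq j)
      rw [qPoch_succ, Nat.add_sub_cancel]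
      have := qPoch_ne_zero hq hq j
      field_simp
      ring
    have h6 := ((h1.mul_left ((u + v) * s)).sub (h2.mul_left (r * s))).sub
      (h4.mul_left (u * v * s))
    have h7 := h3.unique (h6.congr_fun fun j => ?_)
    · linear_combination h7
    · have h5 := one_sub_ne_zero_of_norm_lt (norm_mul_pow_lt hq hq j)
      have := qPoch_ne_zero hq hq j
      obtain ⟨d, hd⟩ : ∃ d, d = 1 - q * q ^ j := ⟨_, rfl⟩
      rw [qPoch_succ, hrec j, ← hd, show q ^ (j + 1) = 1 - d by rw [hd]; ring]
      rw [← hd] at h5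
      field_simp
      ring
  have key := mul_qPochInf_eq_of_qdiff hq hlim (tendsto_qPoch hq (r * b)) hfun
  rw [← key, mul_div_cancel_right₀ _
    (mul_ne_zero (qPochInf_ne_zero hq hu) (qPochInf_ne_zero hq hv))]
  simpa [hΦ] using (hSN 0).hasSum

lemma norm_mul_lt_one {x y : ℂ} (hx : ‖x‖ ≤ 1) (hy : ‖y‖ < 1) : ‖x * y‖ < 1 := by
  rw [norm_mul]
  exact mul_lt_one_of_nonneg_of_lt_one_right hx (norm_nonneg _) hy

lemma summable_pow_succ_mul {r : ℝ} (h0 : 0 ≤ r) (hr : r < 1) (m : ℕ) :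
    Summable fun n : ℕ => ((n : ℝ) + 1) ^ m * r ^ n := by
  -- The index shift that produces n+1 costs one factor of the ratio. Passing from r to (1+r)/2 ≥
  -- 1/2 lets the constant 2 pay for it, even when r = 0.
  have h1 := (summable_nat_add_iff 1).mpr
    (summable_pow_mul_geometric_of_norm_lt_one (R := ℝ) m (r := (1 + r) / 2)
      (by rw [Real.norm_of_nonneg (by linarith)]; linarith))
  refine Summable.of_nonneg_of_le (fun n => by positivity) (fun n => ?_) (h1.mul_left 2)
  have h2 : r ^ n ≤ ((1 + r) / 2) ^ n := pow_le_pow_left₀ h0 (by linarith) n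
  have h3 : (0:ℝ) ≤ ((1 + r) / 2) ^ n := by positivity
  push_cast
  rw [pow_succ ((1 + r) / 2), mul_left_comm]
  have h4 : 2 * (((1 + r) / 2) ^ n * ((1 + r) / 2)) ≥ r ^ n := by nlinarith
  exact mul_le_mul_of_nonneg_left h4 (by positivity)

lemma summable_of_norm_le_pow {x : ℕ → ℂ} {C r : ℝ} {m : ℕ} (h0 : 0 ≤ r) (hr : r < 1)
    (hx : ∀ n, ‖x n‖ ≤ C * (((n : ℝ) + 1) ^ m * r ^ n)) : Summable fun n => ‖x n‖ :=
  Summable.of_nonneg_of_le (fun _ => norm_nonneg _) hx ((summable_pow_succ_mul h0 hr m).mul_left C)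

lemma hasSum_rogersSzego (hq : ‖q‖ < 1) {u v a : ℂ} (hu : ‖u‖ ≤ 1) (hv : ‖v‖ ≤ 1)
    (ha : ‖a‖ < 1) :
    HasSum (fun j => rogersSzego q u v j * a ^ j / qPoch q q j)
      (qPochInf (u * a) q * qPochInf (v * a) q)⁻¹ := by
  obtain ⟨C, h1, hC⟩ := exists_rogersSzego_bound hq
  have := hasSum_of_qHermite_rec hq (u := u) (v := v) (r := 0) (b := a) (g := rogersSzego q u v)
    (fun j => by rw [rogersSzego_succ hq]; ring)
    (summable_of_norm_le_pow (C := C) (m := 1) (norm_nonneg a) ha fun n => by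
      rw [norm_mul, norm_pow, pow_one, ← mul_assoc]
      gcongr
      exact hC u v hu hv n)
    (norm_mul_lt_one hu ha) (norm_mul_lt_one hv ha)
  simpa using this

lemma hasSum_antidiagonal {F : ℕ × ℕ → ℂ} (hF : Summable F) {G : ℕ → ℂ} {S : ℂ}
    (hG : ∀ j, HasSum (fun i => F (i, j)) (G j)) (hS : HasSum G S) :
    HasSum (fun n => ∑ ij ∈ antidiagonal n, F ij) S := by
  have hswap : HasSum (F ∘ Equiv.prodComm ℕ ℕ) (∑' ij, F ij) :=
    (Equiv.hasSum_iff _).mpr hF.hasSum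
  have h1 : HasSum G (∑' ij, F ij) := hswap.prod_fiberwise fun j => hG j
  have h0 : HasSum (fun x : Σ n : ℕ, antidiagonal n => F x.2) (∑' ij, F ij) :=
    (Equiv.hasSum_iff (Finset.HasAntidiagonal.sigmaAntidiagonalEquivProd (A := ℕ))).mpr
      hF.hasSum
  have h2 := h0.sigma (fun n => hasSum_fintype _)
  rw [h1.unique hS] at h2
  exact h2.congr_fun fun n => (sum_coe_sort (antidiagonal n) F).symm

/-- The `q`-Mehler formula. -/
lemma hasSum_qMehler (hq : ‖q‖ < 1) {u v a b : ℂ} (hu : ‖u‖ ≤ 1) (hv : ‖v‖ ≤ 1)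
    (ha : ‖a‖ < 1) (hb : ‖b‖ < 1) :
    HasSum (fun n => rogersSzego q u v n * rogersSzego q a b n / qPoch q q n)
      (qPochInf (u * v * a * b) q /
        (qPochInf (u * a) q * qPochInf (v * a) q * (qPochInf (u * b) q * qPochInf (v * b) q))) := by
  obtain ⟨C, h1, hC⟩ := exists_rogersSzego_bound hq
  obtain ⟨B, hB1, -, hB⟩ := exists_qPoch_bound hq
  set h := rogersSzego q u v with hh
  have hbound : ∀ i j : ℕ, ‖h (i + j) * a ^ i / qPoch q q i‖ ≤
      C * B * ((j : ℝ) + 1) * (((i : ℝ) + 1) * ‖a‖ ^ i) := fun i j => by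
    rw [div_eq_mul_inv, norm_mul, norm_mul, norm_pow]
    calc _ ≤ (C * (((i + j : ℕ) : ℝ) + 1)) * ‖a‖ ^ i * B := by
            gcongr
            exacts [hC u v hu hv _, hB i]
      _ ≤ (C * (((i : ℝ) + 1) * (j + 1))) * ‖a‖ ^ i * B := by
            gcongr
            push_cast
            nlinarith [(Nat.cast_nonneg i : (0:ℝ) ≤ i), (Nat.cast_nonneg j : (0:ℝ) ≤ j)]
      _ = _ := by ring
  have hsa := summable_pow_succ_mul (norm_nonneg a) ha 1
  have hsb := summable_pow_succ_mul (norm_nonneg b) hb 1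
  simp only [pow_one] at hsa hsb
  have hinner : ∀ j, Summable fun i => h (i + j) * a ^ i / qPoch q q i := fun j =>
    Summable.of_norm_bounded (hsa.mul_left _) fun i => hbound i j
  -- The double series ∑ h(i+j) a^i b^j/((q;q)_i (q;q)_j) is summed in two ways: along diagonals it
  -- is the Mehler series, and row by row it is the generating function of `G`, to which
  -- `hasSum_of_qHermite_rec` applies.
  set G : ℕ → ℂ := fun j => ∑' i, h (i + j) * a ^ i / qPoch q q i with hG
  have hG0 : G 0 = (qPochInf (u * a) q * qPochInf (v * a) q)⁻¹ :=
    (hasSum_rogersSzego hq hu hv ha).tsum_eq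
  have hGb : ∀ j, ‖G j‖ ≤ C * B * (∑' i : ℕ, ((i : ℝ) + 1) * ‖a‖ ^ i) * ((j : ℝ) + 1) :=
    fun j => by
      refine (tsum_of_norm_bounded (hsa.mul_left (C * B * ((j : ℝ) + 1))).hasSum
        fun i => hbound i j).trans_eq ?_
      rw [tsum_mul_left]; ring
  -- Use 1 - q^{i+j} = (1 - q^j) + q^j(1 - q^i) in the recurrence of `h`. The first part gives
  -- G(j-1); in the second, 1 - q^i cancels a factor of (q;q)_i and the shift in i gives a·G(j).
  have hGrec : ∀ j, G (j + 1) =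
      (u + v - u * v * a * q ^ j) * G j - u * v * (1 - q ^ j) * G (j - 1) := fun j => by
    have hj := (hinner j).hasSum
    have hj1 := (hinner (j + 1)).hasSum
    have hshift : HasSum (fun i => h (i + j - 1) * (1 - q ^ i) * a ^ i / qPoch q q i)
        (a * G j) := by
      refine (hasSum_succ_iff (by simp)).mp ((hj.mul_left a).congr_fun fun i => ?_)
      have h5 : 1 - q ^ (i + 1) ≠ 0 := by
        rw [pow_succ']; exact one_sub_ne_zero_of_norm_lt (norm_mul_pow_lt hq hq i)
      rw [qPoch_succ, ← pow_succ', show i + 1 + j - 1 = i + j by omega]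
      have := qPoch_ne_zero hq hq i
      field_simp
      ring
    have hpred : HasSum (fun i => (1 - q ^ j) * (h (i + j - 1) * a ^ i / qPoch q q i))
        ((1 - q ^ j) * G (j - 1)) := by
      rcases Nat.eq_zero_or_pos j with rfl | hj0
      · simp [hasSum_zero]
      · refine ((hinner (j - 1)).hasSum.mul_left _).congr_fun fun i => ?_
        rw [Nat.add_sub_assoc hj0]
    refine hj1.unique ((((hj.mul_left (u + v)).sub (hshift.mul_left (u * v * q ^ j))).sub
      (hpred.mul_left (u * v))).congr_fun fun i => ?_) |>.trans (by ring)
    rw [← add_assoc, hh, rogersSzego_succ hq, pow_add]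
    ring
  have houter := hasSum_of_qHermite_rec hq (b := b) hGrec
    (summable_of_norm_le_pow (C := C * B * (∑' i : ℕ, ((i : ℝ) + 1) * ‖a‖ ^ i)) (m := 1)
      (norm_nonneg b) hb fun n => by
        rw [norm_mul, norm_pow, pow_one, ← mul_assoc]
        gcongr
        exact hGb n)
    (norm_mul_lt_one hu hb) (norm_mul_lt_one hv hb)
  have hF : Summable fun ij : ℕ × ℕ =>
      h (ij.1 + ij.2) * a ^ ij.1 / qPoch q q ij.1 * (b ^ ij.2 / qPoch q q ij.2) := by
    refine Summable.of_norm_bounded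
      ((hsa.mul_of_nonneg hsb (fun _ => by positivity) fun _ => by positivity).mul_left
        (C * B * B)) fun ij => ?_
    rw [norm_mul, div_eq_mul_inv (b ^ _), norm_mul, norm_pow b]
    calc _ ≤ C * B * ((ij.2 : ℝ) + 1) * (((ij.1 : ℝ) + 1) * ‖a‖ ^ ij.1) * (‖b‖ ^ ij.2 * B) := by
          gcongr
          exacts [hbound _ _, hB _]
      _ = _ := by ring
  have hval : (G 0 * qPochInf (u * v * a * b) q / (qPochInf (u * b) q * qPochInf (v * b) q)) =
      qPochInf (u * v * a * b) q /
        (qPochInf (u * a) q * qPochInf (v * a) q * (qPochInf (u * b) q * qPochInf (v * b) q)) := by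
    rw [hG0, inv_mul_eq_div, div_div]
  rw [← hval]
  have hfib : ∀ j, HasSum (fun i => h (i + j) * a ^ i / qPoch q q i * (b ^ j / qPoch q q j))
      (G j * b ^ j / qPoch q q j) := fun j => by
    rw [mul_div_assoc (G j)]
    exact (hinner j).hasSum.mul_right _
  refine (hasSum_antidiagonal hF hfib houter).congr_fun fun n => ?_
  rw [mul_div_assoc, rogersSzego_div hq, mul_sum]
  refine sum_congr rfl fun ij hij => ?_
  rw [mem_antidiagonal.mp hij, mul_div_assoc, mul_assoc]

end GeneratingFunctions

/-! ### Connection coefficients between bases, by way of Chebyshev polynomials. -/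

section ChangeOfBase

variable {q : ℂ}

/-- The homogeneous Chebyshev polynomial of the second kind,
`chebU e^{iθ} e^{-iθ} m = U_m(cos θ)`. -/
noncomputable def chebU (u v : ℂ) (m : ℕ) : ℂ := ∑ k ∈ range (m + 1), u ^ k * v ^ (m - k)

lemma chebU_succ (u v : ℂ) (m : ℕ) : chebU u v (m + 1) = u * chebU u v m + v ^ (m + 1) := by
  rw [chebU, sum_range_succ', chebU, mul_sum]
  congr 1
  · exact sum_congr rfl fun k _ => by rw [Nat.add_sub_add_right]; ring
  · simp

lemma chebU_succ_succ (u v : ℂ) (m : ℕ) :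
    chebU u v (m + 2) = (u + v) * chebU u v (m + 1) - u * v * chebU u v m := by
  rw [chebU_succ u v (m + 1), chebU_succ u v m]
  ring

lemma qBinom_succ_mul_sub (hq : ‖q‖ < 1) (n k : ℕ) :
    qBinom q (n + 1) k * (1 - q ^ (n + 1 - k)) = (1 - q ^ (n + 1)) * qBinom q n k := by
  rcases le_or_gt k n with h | h
  · rw [← qBinom_symm (Nat.le_succ_of_le h), ← qBinom_symm h, Nat.succ_sub h]
    exact qBinom_succ_mul hq n (n - k)
  · rw [qBinom_of_lt h, Nat.sub_eq_zero_of_le h]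
    simp

/-- The coefficient of `H_{m-2j}(x|q)` in `U_m(x)`. -/
noncomputable def chebCoeff (q : ℂ) (m j : ℕ) : ℂ :=
  (-1) ^ j * q ^ ((j + 1).choose 2) * qBinom q (m - j) j

lemma chebCoeff_zero (hq : ‖q‖ < 1) (m : ℕ) : chebCoeff q m 0 = 1 := by
  simp [chebCoeff, qBinom_zero_right hq]

lemma chebCoeff_eq_zero {m j : ℕ} (h : m < 2 * j) : chebCoeff q m j = 0 := by
  rw [chebCoeff, qBinom_of_lt (by omega), mul_zero]

/-- This is the comparison of coefficients when the Chebyshev recurrence is applied to an expansion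
in polynomials obeying the q-Hermite recurrence. -/
lemma chebCoeff_rec (hq : ‖q‖ < 1) {m j : ℕ} (h : j ≤ m) :
    chebCoeff q (m + 2) (j + 1) = chebCoeff q (m + 1) (j + 1) +
      (1 - q ^ (m + 1 - 2 * j)) * chebCoeff q (m + 1) j - chebCoeff q m j := by
  obtain ⟨N, rfl⟩ := Nat.exists_eq_add_of_le h
  have e1 : j + N + 2 - (j + 1) = N + 1 := by omega
  have e2 : j + N + 1 - (j + 1) = N := by omega
  have e3 : j + N + 1 - j = N + 1 := by omega
  have e4 : j + N + 1 - 2 * j = N + 1 - j := by omega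
  simp only [chebCoeff, e1, e2, e3, e4, Nat.add_sub_cancel_left]
  have h1 := qBinom_succ_mul_sub hq N j
  have h2 := qBinom_succ_succ' hq N j
  have h3 : q ^ (j + 1) * (q ^ (N - j) * qBinom q N j) = q ^ (N + 1) * qBinom q N j := by
    rcases le_or_gt j N with hj | hj
    · rw [← mul_assoc, ← pow_add, show j + 1 + (N - j) = N + 1 by omega]
    · rw [qBinom_of_lt hj]; simp
  have h4 : q ^ ((j + 1 + 1).choose 2) = q ^ (j + 1) * q ^ ((j + 1).choose 2) := by
    rw [← pow_add, Nat.choose_succ_succ' (j + 1) 1, Nat.choose_one_right]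
  rw [h4, pow_succ (-1 : ℂ)]
  linear_combination (-1) ^ j * q ^ ((j + 1).choose 2) * (-q ^ (j + 1) * h2 - h3 - h1)

/-- Summing up to m instead of ⌊m/2⌋ adds only vanishing coefficients and spares the induction a
distinction by parity. -/
lemma chebU_eq_sum_range_succ (hq : ‖q‖ < 1) (u v : ℂ) (m : ℕ) :
    chebU u v m =
      ∑ j ∈ range (m + 1), chebCoeff q m j * (u * v) ^ j * rogersSzego q u v (m - 2 * j) := by
  induction m using Nat.twoStepInduction with
  | zero => simp [chebU, chebCoeff_zero hq]
  | one =>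
    rw [sum_range_succ, chebCoeff_eq_zero (by norm_num)]
    simp [chebU, sum_range_succ, chebCoeff_zero hq, rogersSzego_one hq, add_comm]
  | more m ih0 ih1 =>
    have h1 : (u + v) * chebU u v (m + 1) = rogersSzego q u v (m + 2) +
        (∑ j ∈ range (m + 1), chebCoeff q (m + 1) (j + 1) * (u * v) ^ (j + 1) *
          rogersSzego q u v (m - 2 * j)) +
        ∑ j ∈ range (m + 1), (1 - q ^ (m + 1 - 2 * j)) * chebCoeff q (m + 1) j *
          (u * v) ^ (j + 1) * rogersSzego q u v (m - 2 * j) := by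
      have e : rogersSzego q u v (m + 2) +
          (∑ j ∈ range (m + 1), chebCoeff q (m + 1) (j + 1) * (u * v) ^ (j + 1) *
            rogersSzego q u v (m - 2 * j)) =
          ∑ j ∈ range (m + 1 + 1), chebCoeff q (m + 1) j * (u * v) ^ j *
            rogersSzego q u v (m + 2 - 2 * j) := by
        rw [sum_range_succ' _ (m + 1), chebCoeff_zero hq, add_comm]
        simp only [pow_zero, mul_zero, Nat.sub_zero, one_mul]
        congr 1
        refine sum_congr rfl fun j _ => ?_
        rw [show m + 2 - 2 * (j + 1) = m - 2 * j by omega]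
      rw [e, ih1, mul_sum, sum_range_succ, sum_range_succ _ (m + 1),
        chebCoeff_eq_zero (show m + 1 < 2 * (m + 1) by omega)]
      simp only [zero_mul, mul_zero, add_zero, ← sum_add_distrib]
      refine sum_congr rfl fun j _ => ?_
      rcases lt_or_ge (m + 1) (2 * j) with hj | hj
      · rw [chebCoeff_eq_zero hj]; ring
      · have h := rogersSzego_succ hq u v (m + 1 - 2 * j)
        rw [show m + 1 - 2 * j + 1 = m + 2 - 2 * j by omega,
          show m + 1 - 2 * j - 1 = m - 2 * j by omega] at h
        rw [h]; ring
    rw [chebU_succ_succ, h1, ih0, sum_range_succ' _ (m + 2), sum_range_succ _ (m + 1),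
      chebCoeff_eq_zero (show m + 2 < 2 * (m + 1 + 1) by omega), chebCoeff_zero hq, mul_sum]
    have h2 : ∑ j ∈ range (m + 1), chebCoeff q (m + 2) (j + 1) * (u * v) ^ (j + 1) *
          rogersSzego q u v (m + 2 - 2 * (j + 1)) =
        ∑ j ∈ range (m + 1), chebCoeff q (m + 1) (j + 1) * (u * v) ^ (j + 1) *
          rogersSzego q u v (m - 2 * j) +
        ∑ j ∈ range (m + 1), (1 - q ^ (m + 1 - 2 * j)) * chebCoeff q (m + 1) j *
          (u * v) ^ (j + 1) * rogersSzego q u v (m - 2 * j) -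
        ∑ j ∈ range (m + 1), u * v * (chebCoeff q m j * (u * v) ^ j *
          rogersSzego q u v (m - 2 * j)) := by
      rw [← sum_add_distrib, ← sum_sub_distrib]
      refine sum_congr rfl fun j hj => ?_
      rw [chebCoeff_rec hq (Nat.lt_succ_iff.mp (mem_range.mp hj)),
        show m + 2 - 2 * (j + 1) = m - 2 * j by omega]
      ring
    rw [h2]
    simp only [pow_zero, mul_zero, zero_mul, Nat.sub_zero, one_mul, add_zero]
    ring

lemma chebU_eq_sum (hq : ‖q‖ < 1) (u v : ℂ) (m : ℕ) :
    chebU u v m =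
      ∑ j ∈ range (m / 2 + 1), chebCoeff q m j * (u * v) ^ j * rogersSzego q u v (m - 2 * j) := by
  rw [chebU_eq_sum_range_succ hq]
  refine (sum_subset (range_mono (by omega)) fun j _ hj => ?_).symm
  rw [mem_range, not_lt] at hj
  rw [chebCoeff_eq_zero (by omega), zero_mul, zero_mul]

/-- A sum with symmetric coefficients in terms of Chebyshev polynomials. -/
lemma sum_symm_eq_sum_chebU (u v : ℂ) (n : ℕ) (b : ℕ → ℂ) (hb : ∀ k ≤ n, b (n - k) = b k) :
    ∑ k ∈ range (n + 1), b k * u ^ k * v ^ (n - k) =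
      ∑ i ∈ range (n / 2 + 1), (b i - if i = 0 then 0 else b (i - 1)) * (u * v) ^ i *
        chebU u v (n - 2 * i) := by
  induction n using Nat.twoStepInduction generalizing b with
  | zero => simp [chebU]
  | one =>
    have := hb 0 zero_le_one
    simp only [Nat.sub_zero] at this
    simp [sum_range_succ, chebU, this]
    ring
  | more n ih _ =>
    have hn := hb 0 (Nat.zero_le _)
    rw [Nat.sub_zero] at hn
    -- Subtracting b 0 · U_{n+2} removes both end terms. What is left is uv times a sum of degree n,
    -- again with symmetric coefficients.
    have h := ih (fun k => b (k + 1) - b 0) fun k hk => by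
      have := hb (k + 1) (by omega)
      rw [show n + 2 - (k + 1) = n - k + 1 by omega] at this
      rw [this]
    have e1 : ∑ k ∈ range (n + 2 + 1), b k * u ^ k * v ^ (n + 2 - k) - b 0 * chebU u v (n + 2) =
        u * v * ∑ k ∈ range (n + 1), (b (k + 1) - b 0) * u ^ k * v ^ (n - k) := by
      rw [chebU, mul_sum, ← sum_sub_distrib, sum_range_succ, sum_range_succ', hn, mul_sum]
      simp only [Nat.sub_self, pow_zero, mul_one, Nat.sub_zero, one_mul, sub_self, add_zero]
      refine sum_congr rfl fun k hk => ?_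
      rw [show n + 2 - (k + 1) = n - k + 1 by have := mem_range.mp hk; omega]
      ring
    have e2 : (n + 2) / 2 + 1 = n / 2 + 1 + 1 := by omega
    rw [e2, sum_range_succ' _ (n / 2 + 1), ← sub_eq_iff_eq_add]
    simp only [if_true, sub_zero, pow_zero, mul_one, mul_zero, Nat.sub_zero]
    rw [e1, h, mul_sum]
    refine sum_congr rfl fun i _ => ?_
    rw [if_neg i.succ_ne_zero, show n + 2 - 2 * (i + 1) = n - 2 * i by omega, Nat.add_sub_cancel]
    rcases i with _ | i
    · simp; ring
    · simp; ring

/-- The change of base formula for `q`-Hermite polynomials. -/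
lemma rogersSzego_change_base {p : ℂ} (hp : ‖p‖ < 1) (hq : ‖q‖ < 1) (u v : ℂ) (n : ℕ) :
    rogersSzego p u v n =
      ∑ k ∈ range (n / 2 + 1), cCoeff p q n k * (u * v) ^ k * rogersSzego q u v (n - 2 * k) := by
  rw [rogersSzego, sum_symm_eq_sum_chebU u v n (qBinom p n) fun k hk => qBinom_symm hk]
  have e1 : ∀ i ∈ range (n / 2 + 1),
      (qBinom p n i - if i = 0 then 0 else qBinom p n (i - 1)) * (u * v) ^ i *
        chebU u v (n - 2 * i) =
      ∑ j ∈ range (n / 2 + 1 - i), (qBinom p n i - if i = 0 then 0 else qBinom p n (i - 1)) *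
        chebCoeff q (n - 2 * i) j * (u * v) ^ (i + j) *
        rogersSzego q u v (n - 2 * (i + j)) := fun i hi => by
    rw [chebU_eq_sum hq, mul_sum,
      show (n - 2 * i) / 2 + 1 = n / 2 + 1 - i by have := mem_range.mp hi; omega]
    refine sum_congr rfl fun j _ => ?_
    rw [show n - 2 * i - 2 * j = n - 2 * (i + j) by omega]
    ring
  rw [sum_congr rfl e1, ← sum_range_diag_flip]
  refine sum_congr rfl fun k hk => ?_
  rw [cCoeff, sum_mul, sum_mul, ← sum_range_reflect]
  refine sum_congr rfl fun j hj => ?_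
  have hk' := mem_range.mp hk
  have hj' := mem_range.mp hj
  rw [show k + 1 - 1 - j = k - j by omega, show k - j + (k - (k - j)) = k by omega,
    show k - (k - j) = j by omega, chebCoeff, show n - 2 * (k - j) - j = n - 2 * k + j by omega]
  -- With i = k-j-1 this is (1 - p^{i+1})[n,i+1] = (1 - p^{n-i})[n,i], rearranged into the form used
  -- in `cCoeff`.
  have key : (qBinom p n (k - j) - if k - j = 0 then 0 else qBinom p n (k - j - 1)) =
      p ^ (k - j) * (qBinom p n (k - j) -
        if j < k then p ^ (n - 2 * k + 2 * j + 1) * qBinom p n (k - j - 1) else 0) := by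
    rcases (Nat.lt_succ_iff.mp hj').eq_or_lt with rfl | h
    · simp
    · obtain ⟨i, rfl⟩ := Nat.exists_eq_add_of_lt h
      rw [if_pos h, show j + i + 1 - j = i + 1 by omega, if_neg i.succ_ne_zero, Nat.add_sub_cancel,
        mul_sub, ← mul_assoc, ← pow_add,
        show i + 1 + (n - 2 * (j + i + 1) + 2 * j + 1) = n - i by omega]
      linear_combination qBinom_mul_sub hp n i
  rw [key]
  ring

end ChangeOfBase

/-! ### Euler's expansion and Cauchy's series. -/

section Euler

variable {q : ℂ}

/-- The coefficients in Euler's expansion of `(y;q)_∞`. -/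
noncomputable def eulerCoeff (q : ℂ) (i : ℕ) : ℂ := (-1) ^ i * q ^ i.choose 2 / qPoch q q i

lemma eulerCoeff_succ_mul (hq : ‖q‖ < 1) (i : ℕ) :
    eulerCoeff q (i + 1) * (1 - q ^ (i + 1)) = -q ^ i * eulerCoeff q i := by
  have h1 := qPoch_ne_zero hq hq i
  have h2 : 1 - q ^ (i + 1) ≠ 0 := one_sub_ne_zero_of_norm_lt (norm_pow_lt_one hq i.succ_ne_zero)
  rw [eulerCoeff, eulerCoeff, qPoch_succ, ← pow_succ', Nat.choose_succ_succ' i 1,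
    Nat.choose_one_right, pow_add]
  field_simp
  ring

lemma summable_norm_eulerCoeff (hq : ‖q‖ < 1) : Summable fun i => ‖eulerCoeff q i‖ := by
  refine summable_div_qPoch hq ?_
  rw [← summable_nat_add_iff 1]
  refine Summable.of_nonneg_of_le (fun _ => norm_nonneg _) (fun i => ?_)
    (summable_geometric_of_lt_one (norm_nonneg q) hq)
  rw [norm_mul, norm_pow, norm_neg, norm_one, one_pow, one_mul, norm_pow]
  refine pow_le_pow_of_le_one (norm_nonneg _) hq.le ?_
  rw [Nat.choose_succ_succ' i 1, Nat.choose_one_right]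
  omega

lemma norm_eulerCoeff_mul_le (q : ℂ) {y : ℂ} (hy : ‖y‖ ≤ 1) (i : ℕ) :
    ‖eulerCoeff q i * y ^ i‖ ≤ ‖eulerCoeff q i‖ := by
  rw [norm_mul, norm_pow]
  exact mul_le_of_le_one_right (norm_nonneg _) (pow_le_one₀ (norm_nonneg _) hy)

/-- Euler's expansion of `(y;q)_∞`. -/
lemma hasSum_euler (hq : ‖q‖ < 1) {y : ℂ} (hy : ‖y‖ ≤ 1) :
    HasSum (fun i => eulerCoeff q i * y ^ i) (qPochInf y q) := by
  have hyN : ∀ N : ℕ, ‖y * q ^ N‖ ≤ 1 := fun N => by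
    rw [norm_mul, norm_pow]
    exact mul_le_one₀ hy (by positivity) (pow_le_one₀ (norm_nonneg _) hq.le)
  have hE := summable_norm_eulerCoeff hq
  have hS : ∀ N : ℕ, Summable fun i => eulerCoeff q i * (y * q ^ N) ^ i := fun N =>
    Summable.of_norm_bounded hE (norm_eulerCoeff_mul_le q (hyN N))
  set Φ : ℕ → ℂ := fun N => ∑' i, eulerCoeff q i * (y * q ^ N) ^ i with hΦ
  have hlim : Tendsto Φ atTop (𝓝 1) := by
    have h := tendsto_tsum_of_dominated_convergence (𝓕 := atTop)
      (f := fun (N i : ℕ) => eulerCoeff q i * (y * q ^ N) ^ i)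
      (g := fun i => if i = 0 then 1 else 0) hE (fun i => ?_)
      (Eventually.of_forall fun N => norm_eulerCoeff_mul_le q (hyN N))
    · simpa using h
    · rcases eq_or_ne i 0 with rfl | hi
      · simp [eulerCoeff]
      · have : Tendsto (fun N : ℕ => y * q ^ N) atTop (𝓝 (y * 0)) :=
          (tendsto_pow_atTop_nhds_zero_of_norm_lt_one hq).const_mul y
        simpa [hi] using (this.pow i).const_mul (eulerCoeff q i)
  -- Euler's series satisfies E(s) = (1-s)E(qs); the parameters u = v = 0 fit this to
  -- `mul_qPochInf_eq_of_qdiff`.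
  have hfun : ∀ N, Φ N * ((1 - 0 * q ^ N) * (1 - 0 * q ^ N)) = Φ (N + 1) * (1 - y * q ^ N) :=
    fun N => by
      set s := y * q ^ N with hs
      have h1 : HasSum (fun i => eulerCoeff q i * s ^ i) (Φ N) := (hS N).hasSum
      have h2 : HasSum (fun i => eulerCoeff q i * s ^ i * q ^ i) (Φ (N + 1)) := by
        refine (hS (N + 1)).hasSum.congr_fun fun i => ?_
        rw [hs]; ring
      have h3 := (hasSum_succ_iff (by simp)).mpr (h1.sub h2)
      have h4 := h3.unique ((h2.mul_left (-s)).congr_fun fun i => by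
        linear_combination s ^ (i + 1) * eulerCoeff_succ_mul hq i)
      linear_combination h4
  have key := mul_qPochInf_eq_of_qdiff hq hlim (tendsto_qPoch hq y) hfun
  simp only [qPochInf_zero, mul_one, one_mul] at key
  rw [← key]
  simpa [hΦ] using (hS 0).hasSum

/-- The terms of Cauchy's series for `1/(q;q)_∞`. -/
noncomputable def cauchyTerm (q : ℂ) (n j : ℕ) : ℂ :=
  q ^ (j ^ 2 + n * j) / (qPoch q q j * qPoch q q (n + j))

lemma exists_cauchyTerm_bound (hq : ‖q‖ < 1) :
    ∃ B : ℝ, ∀ n j, ‖cauchyTerm q n j‖ ≤ B * ‖q‖ ^ j := by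
  obtain ⟨B, h1, -, hB⟩ := exists_qPoch_bound hq
  refine ⟨B * B, fun n j => ?_⟩
  rw [cauchyTerm, div_eq_mul_inv, mul_inv, norm_mul, norm_mul, norm_pow, mul_comm]
  gcongr ?_ * ?_ * ?_
  · exact hB _
  · exact hB _
  · exact pow_le_pow_of_le_one (norm_nonneg _) hq.le (by nlinarith [Nat.zero_le (n * j)])

lemma summable_cauchyTerm (hq : ‖q‖ < 1) (n : ℕ) : Summable (cauchyTerm q n) := by
  obtain ⟨B, hB⟩ := exists_cauchyTerm_bound hq
  exact Summable.of_norm_bounded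
    ((summable_geometric_of_lt_one (norm_nonneg q) hq).mul_left B) (hB n)

lemma tendsto_tsum_cauchyTerm (hq : ‖q‖ < 1) :
    Tendsto (fun n => ∑' j, cauchyTerm q n j) atTop (𝓝 (qPochInf q q)⁻¹) := by
  obtain ⟨B, hB⟩ := exists_cauchyTerm_bound hq
  have hinv := (tendsto_qPoch hq q).inv₀ (qPochInf_ne_zero hq hq)
  have h := tendsto_tsum_of_dominated_convergence (𝓕 := atTop)
    (f := fun (n j : ℕ) => cauchyTerm q n j) (g := fun j => if j = 0 then (qPochInf q q)⁻¹ else 0)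
    ((summable_geometric_of_lt_one (norm_nonneg q) hq).mul_left B) (fun j => ?_)
    (Eventually.of_forall hB)
  · simpa using h
  · rcases eq_or_ne j 0 with rfl | hj
    · simpa [cauchyTerm] using hinv
    · have h1 : Tendsto (fun n : ℕ => (q ^ j) ^ n) atTop (𝓝 0) :=
        tendsto_pow_atTop_nhds_zero_of_norm_lt_one (norm_pow_lt_one hq hj)
      have h2 := (hinv.comp (tendsto_add_atTop_nat j)).mul
        (h1.const_mul (q ^ (j ^ 2) * (qPoch q q j)⁻¹))
      rw [mul_zero, mul_zero] at h2
      simp only [if_neg hj]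
      refine h2.congr fun n => ?_
      simp only [Function.comp, cauchyTerm, div_eq_mul_inv, mul_inv]
      ring

/-- In S_n - S_{n+1} + q^{n+1}S_{n+1} each term acquires the factor 1 - q^j, which cancels against
(q;q)_j; shifting j then produces q^{n+1}S_{n+2}. -/
lemma tsum_cauchyTerm_sub (hq : ‖q‖ < 1) (n : ℕ) :
    (∑' j, cauchyTerm q n j) - ∑' j, cauchyTerm q (n + 1) j =
      q ^ (n + 1) * ((∑' j, cauchyTerm q (n + 2) j) - ∑' j, cauchyTerm q (n + 1) j) := by
  have h0 := (summable_cauchyTerm hq n).hasSum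
  have h1 := (summable_cauchyTerm hq (n + 1)).hasSum
  have h2 := (summable_cauchyTerm hq (n + 2)).hasSum
  have hx : HasSum
      (fun j => q ^ (j ^ 2 + n * j) * (1 - q ^ j) / (qPoch q q j * qPoch q q (n + 1 + j)))
      (q ^ (n + 1) * ∑' j, cauchyTerm q (n + 2) j) := by
    refine (hasSum_succ_iff (by simp)).mp ((h2.mul_left _).congr_fun fun j => ?_)
    have e1 : 1 - q ^ (j + 1) ≠ 0 := one_sub_ne_zero_of_norm_lt (norm_pow_lt_one hq j.succ_ne_zero)
    have e2 := qPoch_ne_zero hq hq j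
    have e3 := qPoch_ne_zero hq hq (n + 2 + j)
    rw [cauchyTerm, qPoch_succ q q j, ← pow_succ', show n + 1 + (j + 1) = n + 2 + j by ring]
    field_simp
    ring
  have h3 := hx.unique (((h0.sub h1).add (h1.mul_left (q ^ (n + 1)))).congr_fun fun j => ?_)
  · linear_combination -h3
  · have e1 : 1 - q ^ (n + j + 1) ≠ 0 :=
      one_sub_ne_zero_of_norm_lt (norm_pow_lt_one hq (Nat.succ_ne_zero _))
    have e2 := qPoch_ne_zero hq hq j
    have e3 := qPoch_ne_zero hq hq (n + j)
    rw [cauchyTerm, cauchyTerm, show n + 1 + j = n + j + 1 by ring, qPoch_succ q q (n + j),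
      ← pow_succ']
    field_simp
    ring

/-- Cauchy's series for `1/(q;q)_∞`. -/
lemma tsum_cauchyTerm (hq : ‖q‖ < 1) (n : ℕ) :
    ∑' j, cauchyTerm q n j = (qPochInf q q)⁻¹ := by
  set S : ℕ → ℂ := fun n => ∑' j, cauchyTerm q n j with hS
  have hlim : Tendsto S atTop (𝓝 (qPochInf q q)⁻¹) := tendsto_tsum_cauchyTerm hq
  -- The norms of consecutive differences are nondecreasing, because |q^{n+1}| < 1, yet they tend to
  -- 0. Hence all differences vanish and S equals its limit.
  have hmono : Monotone fun n => ‖S n - S (n + 1)‖ := monotone_nat_of_le_succ fun n => by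
    rw [tsum_cauchyTerm_sub hq n, norm_mul, norm_sub_rev (S (n + 1))]
    exact mul_le_of_le_one_left (norm_nonneg _) (norm_pow_lt_one hq n.succ_ne_zero).le
  have hdiff : Tendsto (fun n => ‖S n - S (n + 1)‖) atTop (𝓝 0) := by
    simpa using (hlim.sub (hlim.comp (tendsto_add_atTop_nat 1))).norm
  have hconst : ∀ n, S n = S (n + 1) := fun n =>
    sub_eq_zero.mp (norm_le_zero_iff.mp (hmono.ge_of_tendsto hdiff n))
  have hall : ∀ m, S (n + m) = S n := fun m => by
    induction m with
    | zero => rfl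
    | succ m ih => rw [← add_assoc, ← hconst, ih]
  refine tendsto_nhds_unique (tendsto_const_nhds (x := S n) (f := atTop (α := ℕ)))
    ((hlim.comp (tendsto_add_atTop_nat n)).congr fun m => ?_)
  rw [Function.comp, add_comm, hall]

end Euler

/-! ### The q-Hermite weight, its functional and orthogonality. -/

section Functional

variable {q : ℂ}

/-- `e^{iθ}`. -/
noncomputable def circ (θ : ℝ) : ℂ := Complex.exp (I * θ)

/-- `e^{-iθ}`. -/
noncomputable def circInv (θ : ℝ) : ℂ := Complex.exp (-(I * θ))

@[fun_prop] lemma continuous_circ : Continuous circ := by unfold circ; fun_prop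

@[fun_prop] lemma continuous_circInv : Continuous circInv := by unfold circInv; fun_prop

lemma norm_circ (θ : ℝ) : ‖circ θ‖ = 1 := by
  rw [circ, mul_comm]; exact Complex.norm_exp_ofReal_mul_I θ

lemma norm_circInv (θ : ℝ) : ‖circInv θ‖ = 1 := by
  rw [circInv, show -(I * (θ : ℂ)) = ((-θ : ℝ) : ℂ) * I by push_cast; ring]
  exact Complex.norm_exp_ofReal_mul_I _

@[simp] lemma circ_mul_circInv (θ : ℝ) : circ θ * circInv θ = 1 := by
  rw [circ, circInv, ← Complex.exp_add, add_neg_cancel, Complex.exp_zero]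

lemma exp_two_eq (θ : ℝ) : Complex.exp (2 * I * θ) = circ θ ^ 2 := by
  rw [circ, ← Complex.exp_nat_mul]; congr 1; push_cast; ring

lemma exp_neg_two_eq (θ : ℝ) : Complex.exp (-(2 * I * θ)) = circInv θ ^ 2 := by
  rw [circInv, ← Complex.exp_nat_mul]; congr 1; push_cast; ring

lemma circ_pi_sub (θ : ℝ) : circ (Real.pi - θ) = -circInv θ := by
  rw [circ, circInv, show I * ((Real.pi - θ : ℝ) : ℂ) = Real.pi * I + -(I * θ) by push_cast; ring,
    Complex.exp_add, Complex.exp_pi_mul_I]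
  ring

lemma circInv_pi_sub (θ : ℝ) : circInv (Real.pi - θ) = -circ θ := by
  have h := circ_pi_sub (Real.pi - θ)
  rw [sub_sub_cancel] at h
  rw [h, neg_neg]

lemma integral_circ (i j : ℕ) :
    ∫ θ in (0 : ℝ)..Real.pi, (circ θ ^ 2) ^ i * (circInv θ ^ 2) ^ j =
      if i = j then (Real.pi : ℂ) else 0 := by
  split_ifs with h
  · subst h
    have : ∀ θ, (circ θ ^ 2) ^ i * (circInv θ ^ 2) ^ i = 1 := fun θ => by
      rw [← mul_pow, ← mul_pow, circ_mul_circInv, one_pow, one_pow]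
    simp [this]
  · have hc : (2 * I * ((i : ℂ) - j)) ≠ 0 :=
      mul_ne_zero (by simp) (sub_ne_zero.mpr (Nat.cast_injective.ne h))
    have e : ∀ θ : ℝ, (circ θ ^ 2) ^ i * (circInv θ ^ 2) ^ j =
        Complex.exp ((2 * I * ((i : ℂ) - j)) * θ) := fun θ => by
      rw [← exp_two_eq, ← exp_neg_two_eq, ← Complex.exp_nat_mul, ← Complex.exp_nat_mul,
        ← Complex.exp_add]
      congr 1; ring
    simp only [e]
    rw [integral_exp_mul_complex hc]
    have e2 : Complex.exp ((2 * I * ((i : ℂ) - j)) * (Real.pi : ℝ)) = 1 := by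
      rw [show (2 * I * ((i : ℂ) - j)) * (Real.pi : ℝ) =
        (((i : ℤ) - (j : ℤ) : ℤ) : ℂ) * (2 * Real.pi * I) by push_cast; ring]
      exact Complex.exp_int_mul_two_pi_mul_I _
    rw [e2]
    simp

lemma hasSum_integral_of_bound {F : ℕ → ℝ → ℂ} {f : ℝ → ℂ} {b : ℕ → ℝ}
    (hF : ∀ n, Continuous (F n)) (hb : Summable b) (hFb : ∀ n θ, ‖F n θ‖ ≤ b n)
    (hf : ∀ θ, HasSum (fun n => F n θ) (f θ)) :
    HasSum (fun n => ∫ θ in (0 : ℝ)..Real.pi, F n θ) (∫ θ in (0 : ℝ)..Real.pi, f θ) :=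
  intervalIntegral.hasSum_integral_of_dominated_convergence (fun n _ => b n)
    (fun n => (hF n).aestronglyMeasurable) (fun n => ae_of_all _ fun θ _ => hFb n θ)
    (ae_of_all _ fun _ _ => hb) intervalIntegrable_const (ae_of_all _ fun θ _ => hf θ)

lemma norm_sq_pow_le {x : ℂ} (hx : ‖x‖ = 1) (m : ℕ) : ‖(x ^ 2) ^ m‖ ≤ 1 := by
  simp [norm_pow, hx]

/-- Euler's expansion is integrated termwise and only the index i = m survives. The case |c| = 1 is
allowed because the Euler coefficients are absolutely summable. -/
lemma integral_circ_mul_qPochInf (hq : ‖q‖ < 1) {c : ℂ} (hc : ‖c‖ ≤ 1) (m : ℕ) :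
    ∫ θ in (0 : ℝ)..Real.pi, (circ θ ^ 2) ^ m * qPochInf (c * circInv θ ^ 2) q =
      Real.pi * (eulerCoeff q m * c ^ m) := by
  have hn : ∀ θ, ‖c * circInv θ ^ 2‖ ≤ 1 := fun θ => by
    simpa [norm_pow, norm_circInv] using hc
  have h := hasSum_integral_of_bound
    (F := fun i θ => (circ θ ^ 2) ^ m * (eulerCoeff q i * (c * circInv θ ^ 2) ^ i))
    (fun i => by fun_prop) (summable_norm_eulerCoeff hq)
    (fun i θ => by
      rw [norm_mul]
      exact (mul_le_of_le_one_left (norm_nonneg _) (norm_sq_pow_le (norm_circ θ) m)).trans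
        (norm_eulerCoeff_mul_le q (hn θ) i))
    (fun θ => (hasSum_euler hq (hn θ)).mul_left _)
  have e : ∀ i, ∫ θ in (0 : ℝ)..Real.pi,
      (circ θ ^ 2) ^ m * (eulerCoeff q i * (c * circInv θ ^ 2) ^ i) =
        if i = m then (Real.pi : ℂ) * (eulerCoeff q m * c ^ m) else 0 := fun i => by
    have : ∀ θ, (circ θ ^ 2) ^ m * (eulerCoeff q i * (c * circInv θ ^ 2) ^ i) =
        eulerCoeff q i * c ^ i * ((circ θ ^ 2) ^ m * (circInv θ ^ 2) ^ i) := fun θ => by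
      rw [mul_pow]; ring
    simp only [this, intervalIntegral.integral_const_mul, integral_circ]
    rcases eq_or_ne i m with rfl | hi
    · simp; ring
    · simp [hi, hi.symm]
  simp only [e] at h
  exact h.unique (hasSum_ite_eq m _)

/-- The reflection θ ↦ π - θ interchanges e^{2iθ} and e^{-2iθ}. -/
lemma integral_circInv_mul_qPochInf (hq : ‖q‖ < 1) (m : ℕ) :
    ∫ θ in (0 : ℝ)..Real.pi, (circInv θ ^ 2) ^ m * qPochInf (circ θ ^ 2) q =
      Real.pi * eulerCoeff q m := by
  have h := intervalIntegral.integral_comp_sub_left (a := 0) (b := Real.pi)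
    (fun θ => (circ θ ^ 2) ^ m * qPochInf (1 * circInv θ ^ 2) q) Real.pi
  simp only [circ_pi_sub, circInv_pi_sub, neg_sq, sub_self, sub_zero, one_mul] at h
  rw [h]
  simpa using integral_circ_mul_qPochInf hq (c := 1) (by simp) m

lemma eulerCoeff_mul_eulerCoeff (q : ℂ) (m j : ℕ) :
    eulerCoeff q j * eulerCoeff q (j + m) * q ^ j =
      (-1) ^ m * q ^ m.choose 2 * cauchyTerm q m j := by
  have e1 : ∀ j : ℕ, (j + m).choose 2 + j.choose 2 + j = m.choose 2 + (j ^ 2 + m * j) := fun j => by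
    induction j with
    | zero => simp
    | succ j ih =>
      rw [show j + 1 + m = j + m + 1 by ring, Nat.choose_succ_succ' (j + m) 1,
        Nat.choose_succ_succ' j 1, Nat.choose_one_right, Nat.choose_one_right]
      linarith
  have e2 : q ^ j.choose 2 * q ^ (j + m).choose 2 * q ^ j =
      q ^ m.choose 2 * q ^ (j ^ 2 + m * j) := by
    rw [← pow_add, ← pow_add, ← pow_add, ← e1 j]; congr 1; ring
  have e3 : ((-1 : ℂ) ^ j) * (-1) ^ (j + m) = (-1) ^ m := by
    rw [pow_add, ← mul_assoc, ← mul_pow]; simp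
  rw [eulerCoeff, eulerCoeff, cauchyTerm, add_comm m j]
  linear_combination ((-1) ^ j * (-1) ^ (j + m) * e2 + q ^ m.choose 2 * q ^ (j ^ 2 + m * j) * e3) /
    (qPoch q q j * qPoch q q (j + m))

/-- This correlation of Euler coefficients is what a Fourier coefficient of a product of two Euler
series amounts to; up to a factor it is Cauchy's series. -/
lemma hasSum_eulerCoeff_mul (hq : ‖q‖ < 1) (m : ℕ) :
    HasSum (fun j => eulerCoeff q j * eulerCoeff q (j + m) * q ^ j)
      ((-1) ^ m * q ^ m.choose 2 / qPochInf q q) := by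
  simp only [eulerCoeff_mul_eulerCoeff]
  rw [div_eq_mul_inv, ← tsum_cauchyTerm hq m]
  exact (summable_cauchyTerm hq m).hasSum.mul_left _

lemma exists_bound_of_circle (hq : ‖q‖ < 1) :
    ∃ B : ℝ, ∀ y : ℂ, ‖y‖ ≤ 1 → ‖qPochInf y q‖ ≤ B := by
  obtain ⟨B, hB⟩ := (isCompact_closedBall (0 : ℂ) 1).exists_bound_of_continuousOn
    (continuous_qPochInf hq).continuousOn
  exact ⟨B, fun y hy => hB y (by simpa using hy)⟩

lemma continuous_qPochInf_comp (hq : ‖q‖ < 1) {f : ℝ → ℂ} (hf : Continuous f) :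
    Continuous fun θ => qPochInf (f θ) q := (continuous_qPochInf hq).comp hf

lemma norm_mul_circInv_sq_le (hq : ‖q‖ < 1) (θ : ℝ) : ‖q * circInv θ ^ 2‖ ≤ 1 := by
  simpa [norm_pow, norm_circInv] using hq.le

/-- Fourier coefficients of the theta product, nonnegative side. -/
lemma integral_theta_circ (hq : ‖q‖ < 1) (m : ℕ) :
    ∫ θ in (0 : ℝ)..Real.pi, (circ θ ^ 2) ^ m *
        (qPochInf (circ θ ^ 2) q * qPochInf (q * circInv θ ^ 2) q) =
      Real.pi * ((-1) ^ m * q ^ (m + 1).choose 2 / qPochInf q q) := by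
  obtain ⟨B, hB⟩ := exists_bound_of_circle hq
  have hc := continuous_qPochInf_comp hq (f := fun θ => q * circInv θ ^ 2) (by fun_prop)
  have h := hasSum_integral_of_bound
    (F := fun i θ => (circ θ ^ 2) ^ m * qPochInf (q * circInv θ ^ 2) q *
      (eulerCoeff q i * (circ θ ^ 2) ^ i))
    (fun i => by fun_prop) ((summable_norm_eulerCoeff hq).mul_left (1 * B))
    (fun i θ => by
      rw [norm_mul, norm_mul]
      have h1 := norm_sq_pow_le (norm_circ θ) m
      have h2 := hB _ (norm_mul_circInv_sq_le hq θ)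
      have h3 := norm_eulerCoeff_mul_le q (y := circ θ ^ 2) (by simp [norm_circ]) i
      have h4 : 0 ≤ B := (norm_nonneg _).trans h2
      gcongr)
    (fun θ => (hasSum_euler hq (y := circ θ ^ 2) (by simp [norm_circ])).mul_left _)
  have e : ∀ i, ∫ θ in (0 : ℝ)..Real.pi, (circ θ ^ 2) ^ m * qPochInf (q * circInv θ ^ 2) q *
      (eulerCoeff q i * (circ θ ^ 2) ^ i) =
        Real.pi * q ^ m * (eulerCoeff q i * eulerCoeff q (i + m) * q ^ i) := fun i => by
    have : ∀ θ, (circ θ ^ 2) ^ m * qPochInf (q * circInv θ ^ 2) q *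
        (eulerCoeff q i * (circ θ ^ 2) ^ i) =
        eulerCoeff q i * ((circ θ ^ 2) ^ (i + m) * qPochInf (q * circInv θ ^ 2) q) := fun θ => by
      rw [pow_add]; ring
    simp only [this, intervalIntegral.integral_const_mul, integral_circ_mul_qPochInf hq hq.le]
    rw [pow_add]; ring
  simp only [e] at h
  have h2 := h.unique ((hasSum_eulerCoeff_mul hq m).mul_left (Real.pi * q ^ m))
  rw [Nat.choose_succ_succ' m 1, Nat.choose_one_right, pow_add]
  rw [← sub_eq_zero] at h2 ⊢
  rw [← h2]
  congr 1
  · exact intervalIntegral.integral_congr fun θ _ => by ring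
  · ring

/-- Fourier coefficients of the theta product, positive side. -/
lemma integral_theta_circInv (hq : ‖q‖ < 1) (m : ℕ) :
    ∫ θ in (0 : ℝ)..Real.pi, (circInv θ ^ 2) ^ m *
        (qPochInf (circ θ ^ 2) q * qPochInf (q * circInv θ ^ 2) q) =
      Real.pi * ((-1) ^ m * q ^ m.choose 2 / qPochInf q q) := by
  obtain ⟨B, hB⟩ := exists_bound_of_circle hq
  have hc := continuous_qPochInf_comp hq (f := fun θ => circ θ ^ 2) (by fun_prop)
  have h := hasSum_integral_of_bound
    (F := fun i θ => (circInv θ ^ 2) ^ m * qPochInf (circ θ ^ 2) q *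
      (eulerCoeff q i * (q * circInv θ ^ 2) ^ i))
    (fun i => by fun_prop) ((summable_norm_eulerCoeff hq).mul_left (1 * B))
    (fun i θ => by
      rw [norm_mul, norm_mul]
      have h1 := norm_sq_pow_le (norm_circInv θ) m
      have h2 := hB (circ θ ^ 2) (by simp [norm_circ])
      have h3 := norm_eulerCoeff_mul_le q (norm_mul_circInv_sq_le hq θ) i
      have h4 : 0 ≤ B := (norm_nonneg _).trans h2
      gcongr)
    (fun θ => (hasSum_euler hq (norm_mul_circInv_sq_le hq θ)).mul_left _)
  have e : ∀ i, ∫ θ in (0 : ℝ)..Real.pi, (circInv θ ^ 2) ^ m * qPochInf (circ θ ^ 2) q *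
      (eulerCoeff q i * (q * circInv θ ^ 2) ^ i) =
        Real.pi * (eulerCoeff q i * eulerCoeff q (i + m) * q ^ i) := fun i => by
    have : ∀ θ, (circInv θ ^ 2) ^ m * qPochInf (circ θ ^ 2) q *
        (eulerCoeff q i * (q * circInv θ ^ 2) ^ i) =
        eulerCoeff q i * q ^ i * ((circInv θ ^ 2) ^ (i + m) * qPochInf (circ θ ^ 2) q) :=
      fun θ => by rw [pow_add, mul_pow]; ring
    simp only [this, intervalIntegral.integral_const_mul, integral_circInv_mul_qPochInf hq]
    ring
  simp only [e] at h
  rw [← h.unique ((hasSum_eulerCoeff_mul hq m).mul_left (Real.pi : ℂ))]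
  exact intervalIntegral.integral_congr fun θ _ => by ring

/-- The weight function of the continuous `q`-Hermite polynomials. -/
noncomputable def weight (q : ℂ) (θ : ℝ) : ℂ :=
  qPochInf (circ θ ^ 2) q * qPochInf (circInv θ ^ 2) q

lemma continuous_weight (hq : ‖q‖ < 1) : Continuous (weight q) :=
  (continuous_qPochInf_comp hq (by fun_prop)).mul (continuous_qPochInf_comp hq (by fun_prop))

lemma weight_pi_sub (q : ℂ) (θ : ℝ) : weight q (Real.pi - θ) = weight q θ := by
  rw [weight, weight, circ_pi_sub, circInv_pi_sub, neg_sq, neg_sq, mul_comm]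

/-- The normalized orthogonality functional of the continuous `q`-Hermite polynomials. -/
noncomputable def hermiteFun (q : ℂ) (f : ℝ → ℂ) : ℂ :=
  qPochInf q q / (2 * Real.pi) * ∫ θ in (0 : ℝ)..Real.pi, weight q θ * f θ

lemma hermiteFun_const_mul (q c : ℂ) (f : ℝ → ℂ) :
    hermiteFun q (fun θ => c * f θ) = c * hermiteFun q f := by
  simp only [hermiteFun, mul_left_comm _ c, intervalIntegral.integral_const_mul]

lemma hermiteFun_sum (hq : ‖q‖ < 1) (s : Finset ℕ) {f : ℕ → ℝ → ℂ}
    (hf : ∀ i ∈ s, Continuous (f i)) :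
    hermiteFun q (fun θ => ∑ i ∈ s, f i θ) = ∑ i ∈ s, hermiteFun q (f i) := by
  simp only [hermiteFun, mul_sum]
  rw [← mul_sum]
  congr 1
  exact intervalIntegral.integral_finsetSum fun i hi =>
    ((continuous_weight hq).mul (hf i hi)).intervalIntegrable _ _

lemma hermiteFun_add (hq : ‖q‖ < 1) {f g : ℝ → ℂ} (hf : Continuous f) (hg : Continuous g) :
    hermiteFun q (fun θ => f θ + g θ) = hermiteFun q f + hermiteFun q g := by
  simp only [hermiteFun, mul_add]
  rw [← mul_add]
  congr 1
  exact intervalIntegral.integral_add (((continuous_weight hq).mul hf).intervalIntegrable _ _)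
    (((continuous_weight hq).mul hg).intervalIntegrable _ _)

lemma hasSum_hermiteFun (hq : ‖q‖ < 1) {F : ℕ → ℝ → ℂ} {f : ℝ → ℂ} {b : ℕ → ℝ}
    (hF : ∀ n, Continuous (F n)) (hb : Summable b) (hFb : ∀ n θ, ‖F n θ‖ ≤ b n)
    (hf : ∀ θ, HasSum (fun n => F n θ) (f θ)) :
    HasSum (fun n => hermiteFun q (F n)) (hermiteFun q f) := by
  obtain ⟨B, hB⟩ := exists_bound_of_circle hq
  refine (hasSum_integral_of_bound (F := fun n θ => weight q θ * F n θ)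
    (fun n => (continuous_weight hq).mul (hF n)) (hb.mul_left (B * B)) (fun n θ => ?_)
    fun θ => (hf θ).mul_left _).mul_left _
  rw [norm_mul, weight, norm_mul]
  have h1 := hB (circ θ ^ 2) (by simp [norm_circ])
  have h2 := hB (circInv θ ^ 2) (by simp [norm_circInv])
  have h3 := hFb n θ
  have h4 : 0 ≤ B := (norm_nonneg _).trans h1
  gcongr

/-- When uv = 1 the even Chebyshev polynomial is a geometric sum with ratio v², so the product
telescopes. -/
lemma one_sub_mul_chebU {u v : ℂ} (huv : u * v = 1) (i : ℕ) :
    (1 - v ^ 2) * chebU u v (2 * i) = (u ^ 2) ^ i - (v ^ 2) ^ (i + 1) := by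
  induction i with
  | zero => simp [chebU]
  | succ i ih =>
    rw [show 2 * (i + 1) = 2 * i + 1 + 1 by ring, chebU_succ, chebU_succ]
    have e1 : v ^ (2 * i + 1) = (v ^ 2) ^ i * v := by rw [← pow_mul, pow_succ]
    have e2 : v ^ (2 * i + 1 + 1) = (v ^ 2) ^ i * v ^ 2 := by rw [pow_succ, e1]; ring
    have e3 : u ^ 2 * v ^ 2 = 1 := by rw [← mul_pow, huv, one_pow]
    have e4 : (v ^ 2) ^ (i + 1) = (v ^ 2) ^ i * v ^ 2 := pow_succ _ _
    have e5 : (v ^ 2) ^ (i + 1 + 1) = (v ^ 2) ^ i * v ^ 2 * v ^ 2 := by rw [pow_succ, e4]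
    rw [e1, e2, e5, pow_succ (u ^ 2)]
    rw [e4] at ih
    linear_combination u ^ 2 * ih + ((1 - v ^ 2) * (v ^ 2) ^ i) * huv - (v ^ 2) ^ i * e3

/-- Splitting 1 - e^{-2iθ} off the weight leaves the theta product. By `one_sub_mul_chebU` the
integral is then a difference of two Fourier coefficients; these are opposite, which cancels the 2
in the normalization. -/
lemma hermiteFun_chebU (hq : ‖q‖ < 1) (i : ℕ) :
    hermiteFun q (fun θ => chebU (circ θ) (circInv θ) (2 * i)) =
      (-1) ^ i * q ^ (i + 1).choose 2 := by
  have e : ∀ θ, weight q θ * chebU (circ θ) (circInv θ) (2 * i) =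
      (circ θ ^ 2) ^ i * (qPochInf (circ θ ^ 2) q * qPochInf (q * circInv θ ^ 2) q) -
      (circInv θ ^ 2) ^ (i + 1) *
        (qPochInf (circ θ ^ 2) q * qPochInf (q * circInv θ ^ 2) q) := fun θ => by
    rw [weight, qPochInf_eq hq (circInv θ ^ 2), mul_comm _ q]
    linear_combination qPochInf (circ θ ^ 2) q * qPochInf (q * circInv θ ^ 2) q *
      one_sub_mul_chebU (circ_mul_circInv θ) i
  have hc1 := continuous_qPochInf_comp hq (f := fun θ => q * circInv θ ^ 2) (by fun_prop)
  have hc2 := continuous_qPochInf_comp hq (f := fun θ => circ θ ^ 2) (by fun_prop)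
  simp only [hermiteFun, e]
  rw [intervalIntegral.integral_sub (Continuous.intervalIntegrable (by fun_prop) _ _)
    (Continuous.intervalIntegrable (by fun_prop) _ _), integral_theta_circ hq,
    integral_theta_circInv hq]
  have h1 := qPochInf_ne_zero hq hq
  have h2 : (Real.pi : ℂ) ≠ 0 := by exact_mod_cast Real.pi_ne_zero
  field_simp
  ring

/-- The continuous `q`-Hermite polynomial `H_n(cos θ | q)`. -/
noncomputable def hermite (q : ℂ) (n : ℕ) (θ : ℝ) : ℂ := rogersSzego q (circ θ) (circInv θ) n

@[fun_prop] lemma continuous_hermite (q : ℂ) (n : ℕ) : Continuous (hermite q n) := by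
  unfold hermite rogersSzego; fun_prop

@[simp] lemma hermite_zero (q : ℂ) (θ : ℝ) : hermite q 0 θ = 1 := rogersSzego_zero _ _ _

lemma hermite_succ (hq : ‖q‖ < 1) (n : ℕ) (θ : ℝ) :
    hermite q (n + 1) θ =
      (circ θ + circInv θ) * hermite q n θ - (1 - q ^ n) * hermite q (n - 1) θ := by
  rw [hermite, rogersSzego_succ hq, circ_mul_circInv, one_mul]; rfl

lemma hermite_pi_sub (hq : ‖q‖ < 1) (n : ℕ) (θ : ℝ) :
    hermite q n (Real.pi - θ) = (-1) ^ n * hermite q n θ := by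
  induction n using Nat.twoStepInduction with
  | zero => simp
  | one =>
    rw [hermite_succ hq 0, hermite_succ hq 0, circ_pi_sub, circInv_pi_sub]
    simp
  | more n ih0 ih1 =>
    rw [hermite_succ hq (n + 1), hermite_succ hq (n + 1), circ_pi_sub, circInv_pi_sub, ih1,
      Nat.add_sub_cancel, ih0]
    ring

/-- Odd degrees vanish by the reflection θ ↦ π - θ. In even degree the functional is applied to the
expansion of U_{2i}: by induction only H_0 and H_{2i} can contribute, and H_0 already accounts for
the whole value. -/
lemma hermiteFun_hermite (hq : ‖q‖ < 1) (n : ℕ) :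
    hermiteFun q (hermite q n) = if n = 0 then 1 else 0 := by
  rcases Nat.even_or_odd' n with ⟨i, rfl | rfl⟩
  · induction i using Nat.strong_induction_on with
    | _ i ih =>
      have h := hermiteFun_chebU hq i
      have e : ∀ θ, chebU (circ θ) (circInv θ) (2 * i) =
          ∑ j ∈ range (i + 1), chebCoeff q (2 * i) j * hermite q (2 * (i - j)) θ := fun θ => by
        rw [chebU_eq_sum hq, Nat.mul_div_cancel_left _ two_pos]
        refine sum_congr rfl fun j _ => ?_
        rw [circ_mul_circInv, one_pow, mul_one, Nat.mul_sub]
        rfl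
      simp only [e] at h
      rw [hermiteFun_sum hq _ fun j _ => by fun_prop] at h
      simp only [hermiteFun_const_mul] at h
      rcases Nat.eq_zero_or_pos i with rfl | hi
      · simpa [chebCoeff_zero hq] using h
      · rw [sum_range_succ', chebCoeff_zero hq, one_mul, Nat.sub_zero] at h
        have h2 : ∑ k ∈ range i, chebCoeff q (2 * i) (k + 1) *
            hermiteFun q (hermite q (2 * (i - (k + 1)))) = (-1) ^ i * q ^ (i + 1).choose 2 := by
          rw [sum_eq_single_of_mem (i - 1) (by simp; omega)]
          · have h0 := ih 0 hi
            simp only [mul_zero, if_true] at h0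
            rw [show i - 1 + 1 = i by omega, Nat.sub_self, mul_zero, h0, chebCoeff,
              show 2 * i - i = i by omega, qBinom_self hq]
            ring
          · intro k hk hne
            have hk' := mem_range.mp hk
            rw [ih _ (by omega), if_neg (by omega), mul_zero]
        rw [h2] at h
        rw [if_neg (by omega)]
        linear_combination h
  · rw [if_neg (by omega)]
    have h := intervalIntegral.integral_comp_sub_left (a := 0) (b := Real.pi)
      (fun θ => weight q θ * hermite q (2 * i + 1) θ) Real.pi
    simp only [weight_pi_sub, hermite_pi_sub hq, sub_self, sub_zero] at h
    have e : ∀ θ, weight q θ * ((-1) ^ (2 * i + 1) * hermite q (2 * i + 1) θ) =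
        -(weight q θ * hermite q (2 * i + 1) θ) := fun θ => by
      rw [pow_succ, pow_mul]; simp
    simp only [e, intervalIntegral.integral_neg] at h
    rw [hermiteFun, self_eq_neg.mp h.symm, mul_zero]

/-- Orthogonality of the continuous `q`-Hermite polynomials. -/
lemma hermiteFun_hermite_mul (hq : ‖q‖ < 1) (m n : ℕ) :
    hermiteFun q (fun θ => hermite q m θ * hermite q n θ) = if m = n then qPoch q q n else 0 := by
  -- Multiplication by 2cos θ can be moved from one factor to the other, so the two three-term
  -- recurrences trade degree in m for degree in n; the case m = 0 is `hermiteFun_hermite`.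
  have step : ∀ m n, hermiteFun q (fun θ => hermite q (m + 1) θ * hermite q n θ) =
      hermiteFun q (fun θ => hermite q m θ * hermite q (n + 1) θ) +
      (1 - q ^ n) * hermiteFun q (fun θ => hermite q m θ * hermite q (n - 1) θ) +
      -(1 - q ^ m) * hermiteFun q (fun θ => hermite q (m - 1) θ * hermite q n θ) := fun m n => by
    rw [← hermiteFun_const_mul, ← hermiteFun_const_mul, ← hermiteFun_add hq (by fun_prop)
      (by fun_prop), ← hermiteFun_add hq (by fun_prop) (by fun_prop)]
    congr 1
    funext θ
    rw [hermite_succ hq m, hermite_succ hq n]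
    ring
  have h0 : ∀ n, hermiteFun q (fun θ => hermite q 0 θ * hermite q n θ) =
      if 0 = n then qPoch q q n else 0 := fun n => by
    simp only [hermite_zero, one_mul]
    rw [hermiteFun_hermite hq]
    rcases n with _ | n <;> simp
  have hs : ∀ n, qPoch q q (n + 1) = (1 - q ^ (n + 1)) * qPoch q q n := fun n => by
    rw [qPoch_succ, pow_succ']; ring
  induction m using Nat.twoStepInduction generalizing n with
  | zero => exact h0 n
  | one =>
    rw [step 0 n, h0, h0]
    rcases n with _ | _ | n <;> simp [qPoch_succ]
  | more m ih0 ih1 =>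
    rw [step (m + 1) n, ih1, ih1, Nat.add_sub_cancel, ih0]
    rcases eq_or_ne n (m + 2) with rfl | h1
    · simp [hs (m + 1)]
    rcases eq_or_ne n m with rfl | h2
    · rw [if_pos rfl, if_pos rfl, if_neg (by omega), if_neg (by omega), hs]; ring
    rw [if_neg (show ¬(m + 1 = n + 1) by omega), if_neg h2.symm, if_neg h1.symm]
    rcases n with _ | n
    · simp
    · rw [if_neg (by omega)]; ring

end Functional

/-! ### The Askey–Wilson integral. -/

section AskeyWilson

variable {q : ℂ}

/-- The generating function `1/(c e^{iθ}, c e^{-iθ}; q)_∞` of the `q`-Hermite polynomials. -/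
noncomputable def hermiteGen (q c : ℂ) (θ : ℝ) : ℂ :=
  (qPochInf (circ θ * c) q * qPochInf (circInv θ * c) q)⁻¹

@[simp] lemma hermiteGen_zero (q : ℂ) (θ : ℝ) : hermiteGen q 0 θ = 1 := by simp [hermiteGen]

lemma norm_circ_mul (θ : ℝ) (c : ℂ) : ‖circ θ * c‖ = ‖c‖ := by rw [norm_mul, norm_circ, one_mul]

lemma norm_circInv_mul (θ : ℝ) (c : ℂ) : ‖circInv θ * c‖ = ‖c‖ := by
  rw [norm_mul, norm_circInv, one_mul]

lemma hermiteGen_denom_ne_zero (hq : ‖q‖ < 1) {c : ℂ} (hc : ‖c‖ < 1) (θ : ℝ) :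
    qPochInf (circ θ * c) q * qPochInf (circInv θ * c) q ≠ 0 :=
  mul_ne_zero (qPochInf_ne_zero hq (by rwa [norm_circ_mul]))
    (qPochInf_ne_zero hq (by rwa [norm_circInv_mul]))

lemma continuous_hermiteGen (hq : ‖q‖ < 1) {c : ℂ} (hc : ‖c‖ < 1) :
    Continuous (hermiteGen q c) :=
  ((continuous_qPochInf_comp hq (by fun_prop)).mul
    (continuous_qPochInf_comp hq (by fun_prop))).inv₀ (hermiteGen_denom_ne_zero hq hc)

lemma exists_hermiteGen_bound (hq : ‖q‖ < 1) {c : ℂ} (hc : ‖c‖ < 1) :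
    ∃ B : ℝ, ∀ θ, ‖hermiteGen q c θ‖ ≤ B := by
  obtain ⟨B, hB⟩ := (isCompact_closedBall (0 : ℂ) ‖c‖).exists_bound_of_continuousOn
    (f := fun y => (qPochInf y q)⁻¹)
    ((continuous_qPochInf hq).continuousOn.inv₀ fun y hy =>
      qPochInf_ne_zero hq (lt_of_le_of_lt (by simpa using hy) hc))
  refine ⟨B * B, fun θ => ?_⟩
  have h1 := hB (circ θ * c) (by simp [norm_circ])
  have h2 := hB (circInv θ * c) (by simp [norm_circInv])
  have h3 : 0 ≤ B := (norm_nonneg _).trans h1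
  rw [hermiteGen, mul_inv, norm_mul]
  gcongr

lemma hasSum_hermite_mul (hq : ‖q‖ < 1) {a b : ℂ} (ha : ‖a‖ < 1) (hb : ‖b‖ < 1) (θ : ℝ) :
    HasSum (fun n => hermite q n θ * rogersSzego q a b n / qPoch q q n)
      (qPochInf (a * b) q * (hermiteGen q a θ * hermiteGen q b θ)) := by
  have h := hasSum_qMehler hq (norm_circ θ).le (norm_circInv θ).le ha hb
  rw [circ_mul_circInv, one_mul, div_eq_mul_inv, mul_inv] at h
  exact h

/-- A summable bound for the terms in the previous expansion. -/
lemma exists_hermite_mul_bound (hq : ‖q‖ < 1) {a b : ℂ} (ha : ‖a‖ < 1) (hb : ‖b‖ < 1) :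
    ∃ β : ℕ → ℝ, Summable β ∧
      ∀ n θ, ‖hermite q n θ * rogersSzego q a b n / qPoch q q n‖ ≤ β n := by
  obtain ⟨C, hC1, hC⟩ := exists_rogersSzego_bound_pow hq
  obtain ⟨B, hB1, -, hB⟩ := exists_qPoch_bound hq
  have hr : max ‖a‖ ‖b‖ < 1 := max_lt ha hb
  refine ⟨fun n => C * C * B * (((n : ℝ) + 1) ^ 2 * (max ‖a‖ ‖b‖) ^ n),
    (summable_pow_succ_mul (le_max_of_le_left (norm_nonneg a)) hr 2).mul_left _, fun n θ => ?_⟩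
  have h1 := hC (circ θ) (circInv θ) 1 (norm_circ θ).le (norm_circInv θ).le n
  rw [one_pow, mul_one] at h1
  have h2 := hC a b _ (le_max_left _ _) (le_max_right _ _) n
  rw [div_eq_mul_inv, norm_mul, norm_mul]
  calc _ ≤ (C * ((n : ℝ) + 1)) * (C * (((n : ℝ) + 1) * (max ‖a‖ ‖b‖) ^ n)) * B := by
        gcongr
        exacts [h1, hB n]
    _ = _ := by ring

/-- The two kernels are expanded by the q-Mehler formula, and orthogonality leaves only the term n =
N. -/
lemma hermiteFun_hermite_mul_gen (hq : ‖q‖ < 1) {c d : ℂ} (hc : ‖c‖ < 1) (hd : ‖d‖ < 1) (N : ℕ) :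
    hermiteFun q (fun θ => hermite q N θ * (hermiteGen q c θ * hermiteGen q d θ)) =
      rogersSzego q c d N / qPochInf (c * d) q := by
  obtain ⟨C, hC1, hC⟩ := exists_rogersSzego_bound hq
  obtain ⟨β, hβ, hβb⟩ := exists_hermite_mul_bound hq hc hd
  have h := hasSum_hermiteFun hq
    (F := fun n θ => hermite q N θ * (hermite q n θ * rogersSzego q c d n / qPoch q q n))
    (fun n => by fun_prop) (hβ.mul_left (C * (N + 1)))
    (fun n θ => by
      rw [norm_mul]
      gcongr
      exacts [hC _ _ (norm_circ θ).le (norm_circInv θ).le N, hβb n θ])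
    (fun θ => (hasSum_hermite_mul hq hc hd θ).mul_left (hermite q N θ))
  have e : ∀ n, hermiteFun q (fun θ => hermite q N θ *
      (hermite q n θ * rogersSzego q c d n / qPoch q q n)) =
        if n = N then rogersSzego q c d N else 0 := fun n => by
    have : (fun θ => hermite q N θ * (hermite q n θ * rogersSzego q c d n / qPoch q q n)) =
        fun θ => rogersSzego q c d n / qPoch q q n * (hermite q N θ * hermite q n θ) := by
      funext θ; ring
    rw [this, hermiteFun_const_mul, hermiteFun_hermite_mul hq]
    rcases eq_or_ne n N with rfl | hn
    · simp [div_mul_cancel₀ _ (qPoch_ne_zero hq hq n)]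
    · simp [hn, hn.symm]
  simp only [e] at h
  have h2 := (hasSum_ite_eq N (rogersSzego q c d N)).unique h
  simp only [mul_left_comm _ (qPochInf (c * d) q)] at h2
  rw [hermiteFun_const_mul] at h2
  have hcd : ‖c * d‖ < 1 := norm_mul_lt_one hc.le hd
  rw [h2, mul_div_cancel_left₀ _ (qPochInf_ne_zero hq hcd)]

/-- The Askey–Wilson integral. -/
lemma hermiteFun_askeyWilson (hq : ‖q‖ < 1) {a b c d : ℂ} (ha : ‖a‖ < 1) (hb : ‖b‖ < 1)
    (hc : ‖c‖ < 1) (hd : ‖d‖ < 1) :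
    hermiteFun q (fun θ => hermiteGen q a θ * hermiteGen q b θ *
        (hermiteGen q c θ * hermiteGen q d θ)) =
      qPochInf (a * b * c * d) q /
        (qPochInf (a * b) q * qPochInf (a * c) q * qPochInf (a * d) q *
          qPochInf (b * c) q * qPochInf (b * d) q * qPochInf (c * d) q) := by
  obtain ⟨β, hβ, hβb⟩ := exists_hermite_mul_bound hq ha hb
  obtain ⟨B, hB⟩ := exists_hermiteGen_bound hq hc
  obtain ⟨D, hD⟩ := exists_hermiteGen_bound hq hd
  have hcc := continuous_hermiteGen hq hc
  have hdc := continuous_hermiteGen hq hd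
  have h := hasSum_hermiteFun hq
    (F := fun n θ => hermite q n θ * rogersSzego q a b n / qPoch q q n *
      (hermiteGen q c θ * hermiteGen q d θ))
    (fun n => by fun_prop) (hβ.mul_right (B * D))
    (fun n θ => by
      have h1 := hB θ
      have h2 := hD θ
      have h3 := hβb n θ
      have h4 : 0 ≤ B := (norm_nonneg _).trans h1
      have h5 : 0 ≤ β n := (norm_nonneg _).trans h3
      rw [norm_mul, norm_mul (hermiteGen q c θ)]
      gcongr)
    (fun θ => (hasSum_hermite_mul hq ha hb θ).mul_right _)
  have e : ∀ n, hermiteFun q (fun θ => hermite q n θ * rogersSzego q a b n / qPoch q q n *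
      (hermiteGen q c θ * hermiteGen q d θ)) =
        rogersSzego q a b n * rogersSzego q c d n / qPoch q q n * (qPochInf (c * d) q)⁻¹ :=
    fun n => by
      have : (fun θ => hermite q n θ * rogersSzego q a b n / qPoch q q n *
          (hermiteGen q c θ * hermiteGen q d θ)) =
          fun θ => rogersSzego q a b n / qPoch q q n *
            (hermite q n θ * (hermiteGen q c θ * hermiteGen q d θ)) := by
        funext θ; ring
      rw [this, hermiteFun_const_mul, hermiteFun_hermite_mul_gen hq hc hd]
      ring
  simp only [e, mul_assoc (qPochInf (a * b) q)] at h
  rw [hermiteFun_const_mul] at h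
  -- The q-Mehler formula a second time, with `a` and `b` in the place of e^{iθ} and e^{-iθ}.
  have h2 := h.unique ((hasSum_qMehler hq ha.le hb.le hc hd).mul_right _)
  have hab := qPochInf_ne_zero hq (norm_mul_lt_one ha.le hb)
  rw [← mul_right_inj' hab, h2]
  field_simp

end AskeyWilson

/-! ### Closed forms of the integral at special bases. -/

section SpecialValues

variable {p q a t : ℂ}

lemma hIntegral_eq (p q a t : ℂ) :
    hIntegral p q a t = qPochInf (a * t) p * qPochInf (p * t ^ 2) (p ^ 2) *
      hermiteFun (q ^ 2) (fun θ => hermiteGen (q ^ 2) a θ * hermiteGen p t θ) := by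
  have e : ∀ θ, hIntegrand p q a t θ =
      weight (q ^ 2) θ * (hermiteGen (q ^ 2) a θ * hermiteGen p t θ) := fun θ => by
    rw [hIntegrand, exp_two_eq, exp_neg_two_eq, weight, hermiteGen, hermiteGen, ← mul_inv,
      ← div_eq_mul_inv, circ, circInv, mul_comm a, mul_comm a, mul_comm t, mul_comm t]
  simp only [hIntegral, hermiteFun, e]
  ring

lemma hermiteGen_sq (hq : ‖q‖ < 1) (t : ℂ) (θ : ℝ) :
    hermiteGen q t θ = hermiteGen (q ^ 2) t θ * hermiteGen (q ^ 2) (t * q) θ := by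
  rw [hermiteGen, qPochInf_sq hq (circ θ * t), qPochInf_sq hq (circInv θ * t), hermiteGen,
    hermiteGen, ← mul_inv, mul_assoc (circ θ), mul_assoc (circInv θ)]
  congr 1
  ring

lemma hermiteGen_cube (hq : ‖q‖ < 1) (t : ℂ) (θ : ℝ) :
    hermiteGen q t θ = hermiteGen (q ^ 3) t θ * hermiteGen (q ^ 3) (t * q) θ *
      hermiteGen (q ^ 3) (t * q ^ 2) θ := by
  rw [hermiteGen, qPochInf_cube hq (circ θ * t), qPochInf_cube hq (circInv θ * t), hermiteGen,
    hermiteGen, hermiteGen, ← mul_inv, ← mul_inv]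
  simp only [mul_assoc (circ θ), mul_assoc (circInv θ)]
  congr 1
  ring

/-- The functional sees q only through q², so p = q and p = -q are one case. The kernel G_p(t)
splits into G_{p²}(t) G_{p²}(tp), and the Askey–Wilson parameters are a, t, tp, 0. -/
lemma hIntegral_of_sq_eq (hp : ‖p‖ < 1) (hpq : p ^ 2 = q ^ 2) (ha : ‖a‖ < 1) (ht : ‖t‖ < 1) :
    hIntegral p q a t = 1 := by
  have hp2 := norm_pow_lt_one hp two_ne_zero
  have htp : ‖t * p‖ < 1 := norm_mul_lt_one ht.le hp
  have h := hermiteFun_askeyWilson hp2 ha ht htp (d := 0) (by simp)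
  simp only [hermiteGen_zero, mul_one, mul_zero, qPochInf_zero, mul_assoc (hermiteGen _ a _),
    ← hermiteGen_sq hp] at h
  rw [hIntegral_eq, ← hpq, h, qPochInf_sq hp (a * t)]
  have h1 := qPochInf_ne_zero hp2 (norm_mul_lt_one ha.le ht)
  have h2 := qPochInf_ne_zero hp2 (norm_mul_lt_one ha.le htp)
  have h3 := qPochInf_ne_zero hp2 (norm_mul_lt_one ht.le htp)
  rw [show a * t * p = a * (t * p) by ring, show p * t ^ 2 = t * (t * p) by ring]
  rw [← mul_div_assoc, mul_one, div_self (mul_ne_zero (mul_ne_zero h1 h2) h3)]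

/-- Both kernels already have base q², so the Askey–Wilson integral with c = d = 0 suffices. -/
lemma hIntegral_sq (hq : ‖q‖ < 1) (ha : ‖a‖ < 1) (ht : ‖t‖ < 1) :
    hIntegral (q ^ 2) q a t = qPochInf (q ^ 2 * t ^ 2) (q ^ 4) := by
  have hq2 := norm_pow_lt_one hq two_ne_zero
  have h := hermiteFun_askeyWilson hq2 ha ht (c := 0) (d := 0) (by simp) (by simp)
  simp only [hermiteGen_zero, mul_one, mul_zero, qPochInf_zero] at h
  rw [hIntegral_eq, h, ← pow_mul]
  have h1 := qPochInf_ne_zero hq2 (norm_mul_lt_one ha.le ht)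
  field_simp

/-- Since (q³)² = (q²)³, the kernel in t splits into three of base q⁶, and the Askey–Wilson
parameters are a, t, tq², tq⁴. -/
lemma hIntegral_sq_cube (hq : ‖q‖ < 1) (ha : ‖a‖ < 1) (ht : ‖t‖ < 1) :
    hIntegral (q ^ 2) (q ^ 3) a t =
      qPochInf (a * t ^ 3 * q ^ 6) (q ^ 6) / qPochInf (t ^ 2 * q ^ 4) (q ^ 4) := by
  have hq2 := norm_pow_lt_one hq two_ne_zero
  have hq4 := norm_pow_lt_one hq four_ne_zero
  have hq6 := norm_pow_lt_one hq (n := 6) (by norm_num)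
  have hb : ‖t * q ^ 2‖ < 1 := norm_mul_lt_one ht.le hq2
  have hc : ‖t * q ^ 4‖ < 1 := norm_mul_lt_one ht.le hq4
  have h := hermiteFun_askeyWilson hq6 ha ht hb hc
  have e : ∀ θ, hermiteGen (q ^ 6) a θ * hermiteGen (q ^ 6) t θ *
      (hermiteGen (q ^ 6) (t * q ^ 2) θ * hermiteGen (q ^ 6) (t * q ^ 4) θ) =
      hermiteGen ((q ^ 3) ^ 2) a θ * hermiteGen (q ^ 2) t θ := fun θ => by
    rw [hermiteGen_cube hq2, ← pow_mul, ← pow_mul, ← pow_mul]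
    ring
  simp only [e] at h
  rw [hIntegral_eq, ← pow_mul q 3 2] at *
  simp only [Nat.reduceMul] at *
  rw [h, qPochInf_cube hq2 (a * t), ← pow_mul, ← pow_mul]
  simp only [Nat.reduceMul]
  have h1 := qPochInf_ne_zero hq6 (norm_mul_lt_one ha.le ht)
  have h2 := qPochInf_ne_zero hq6 (norm_mul_lt_one ha.le hb)
  have h3 := qPochInf_ne_zero hq6 (norm_mul_lt_one ha.le hc)
  have h4 := qPochInf_ne_zero hq6 (norm_mul_lt_one ht.le hb)
  have h5 := qPochInf_ne_zero hq6 (norm_mul_lt_one ht.le hc)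
  have h6 := qPochInf_ne_zero hq6 (norm_mul_lt_one hb.le hc)
  have htt : ‖t ^ 2 * q ^ 4‖ < 1 := norm_mul_lt_one (norm_pow_lt_one ht two_ne_zero).le hq4
  have h7 := qPochInf_ne_zero hq4 htt
  -- Splitting (q²t²;q²)_∞ in base q⁴ and in base q⁶ and comparing gives the relation that removes
  -- the factors free of `a`.
  have k1 := qPochInf_sq hq2 (q ^ 2 * t ^ 2)
  have k2 := qPochInf_cube hq2 (q ^ 2 * t ^ 2)
  rw [k1] at k2
  simp only [← pow_mul, Nat.reduceMul] at k2
  rw [show q ^ 2 * t ^ 2 * q ^ 2 = t ^ 2 * q ^ 4 by ring,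
    show q ^ 2 * t ^ 2 * q ^ 4 = t * q ^ 2 * (t * q ^ 4) by ring] at k2
  rw [show t ^ 2 * q ^ 4 = t * (t * q ^ 4) by ring] at k2 h7 ⊢
  rw [show q ^ 2 * t ^ 2 = t * (t * q ^ 2) by ring] at k2 ⊢
  rw [show a * t * q ^ 2 = a * (t * q ^ 2) by ring, show a * t * q ^ 4 = a * (t * q ^ 4) by ring,
    show a * t * (t * q ^ 2) * (t * q ^ 4) = a * t ^ 3 * q ^ 6 by ring]
  generalize qPochInf (a * t) (q ^ 6) = x₁ at *
  generalize qPochInf (a * (t * q ^ 2)) (q ^ 6) = x₂ at *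
  generalize qPochInf (a * (t * q ^ 4)) (q ^ 6) = x₃ at *
  generalize qPochInf (t * (t * q ^ 2)) (q ^ 6) = x₄ at *
  generalize qPochInf (t * (t * q ^ 4)) (q ^ 6) = x₅ at *
  generalize qPochInf (t * q ^ 2 * (t * q ^ 4)) (q ^ 6) = x₆ at *
  generalize qPochInf (t * (t * q ^ 4)) (q ^ 4) = x₇ at *
  generalize qPochInf (t * (t * q ^ 2)) (q ^ 4) = x₈ at *
  generalize qPochInf (a * t ^ 3 * q ^ 6) (q ^ 6) = x₉
  field_simp
  linear_combination x₉ * k2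

end SpecialValues

/-! ### Continuous big q-Hermite polynomials. -/

section BigHermite

variable {p q a t : ℂ}

/-- The continuous big `q`-Hermite polynomial `H_n(cos θ; a | q)`. -/
noncomputable def bigHermite (q a : ℂ) (n : ℕ) (θ : ℝ) : ℂ :=
  ∑ k ∈ range (n + 1),
    qBinom q n k * (-1) ^ k * q ^ k.choose 2 * a ^ k * hermite q (n - k) θ

@[fun_prop] lemma continuous_bigHermite (q a : ℂ) (n : ℕ) : Continuous (bigHermite q a n) := by
  unfold bigHermite; fun_prop

lemma bigHermite_zero (hq : ‖q‖ < 1) (a : ℂ) (θ : ℝ) : bigHermite q a 0 θ = 1 := by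
  simp [bigHermite, qBinom_self hq]

/-- The q-Pascal rule separates the term in a·q^n from a sum with every Hermite degree raised by
one; to that sum the recurrence of H_n applies. -/
lemma bigHermite_succ (hq : ‖q‖ < 1) (a : ℂ) (n : ℕ) (θ : ℝ) :
    bigHermite q a (n + 1) θ = (circ θ + circInv θ - a * q ^ n) * bigHermite q a n θ -
      (1 - q ^ n) * bigHermite q a (n - 1) θ := by
  have h1 : bigHermite q a (n + 1) θ = -(a * q ^ n) * bigHermite q a n θ +
      ∑ k ∈ range (n + 1),
        qBinom q n k * (-1) ^ k * q ^ k.choose 2 * a ^ k * hermite q (n + 1 - k) θ := by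
    have e : ∑ k ∈ range (n + 1),
        qBinom q n k * (-1) ^ k * q ^ k.choose 2 * a ^ k * hermite q (n + 1 - k) θ =
        ∑ k ∈ range (n + 1 + 1),
          qBinom q n k * (-1) ^ k * q ^ k.choose 2 * a ^ k * hermite q (n + 1 - k) θ := by
      rw [sum_range_succ _ (n + 1), qBinom_of_lt n.lt_succ_self]
      simp
    rw [e, bigHermite, bigHermite, sum_range_succ', sum_range_succ' _ (n + 1), mul_sum,
      ← add_assoc, ← sum_add_distrib, qBinom_zero_right hq, qBinom_zero_right hq]
    congr 1
    refine sum_congr rfl fun k hk => ?_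
    have e1 : q ^ n = q ^ (n - k) * q ^ k := by
      rw [← pow_add, Nat.sub_add_cancel (Nat.lt_succ_iff.mp (mem_range.mp hk))]
    rw [qBinom_succ_succ' hq, Nat.add_sub_add_right, Nat.choose_succ_succ' k 1,
      Nat.choose_one_right, pow_add, e1]
    ring
  have h2 : ∑ k ∈ range (n + 1),
        qBinom q n k * (-1) ^ k * q ^ k.choose 2 * a ^ k * hermite q (n + 1 - k) θ =
      (circ θ + circInv θ) * bigHermite q a n θ - (1 - q ^ n) * bigHermite q a (n - 1) θ := by
    have e : ∀ k ∈ range (n + 1),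
        qBinom q n k * (-1) ^ k * q ^ k.choose 2 * a ^ k * hermite q (n + 1 - k) θ =
        (circ θ + circInv θ) *
          (qBinom q n k * (-1) ^ k * q ^ k.choose 2 * a ^ k * hermite q (n - k) θ) -
        qBinom q n k * (1 - q ^ (n - k)) * ((-1) ^ k * q ^ k.choose 2 * a ^ k *
          hermite q (n - k - 1) θ) := fun k hk => by
      rw [Nat.sub_add_comm (Nat.lt_succ_iff.mp (mem_range.mp hk)), hermite_succ hq]
      ring
    rw [sum_congr rfl e, sum_sub_distrib, ← mul_sum]
    congr 1
    rcases n with _ | n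
    · simp
    · rw [sum_range_succ, Nat.sub_self, pow_zero, sub_self, mul_zero, zero_mul, add_zero,
        Nat.add_sub_cancel, bigHermite, mul_sum]
      refine sum_congr rfl fun k _ => ?_
      rw [qBinom_succ_mul_sub hq, show n + 1 - k - 1 = n - k by omega]
      ring
  rw [h1, h2]
  ring

lemma exists_bigHermite_bound (hq : ‖q‖ < 1) (ha : ‖a‖ < 1) :
    ∃ C : ℝ, 1 ≤ C ∧ ∀ n θ, ‖bigHermite q a n θ‖ ≤ C * ((n : ℝ) + 1) ^ 2 := by
  obtain ⟨C, hC1, hC⟩ := exists_rogersSzego_bound hq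
  obtain ⟨B, hB1, hB⟩ := exists_qBinom_bound hq
  refine ⟨B * C, one_le_mul_of_one_le_of_one_le hB1 hC1, fun n θ => ?_⟩
  calc ‖bigHermite q a n θ‖ ≤ ∑ k ∈ range (n + 1), B * C * ((n : ℝ) + 1) := by
        refine norm_sum_le_of_le _ fun k _ => ?_
        have h1 := hB n k
        have h2 : ‖q ^ k.choose 2‖ ≤ 1 := by
          rw [norm_pow]; exact pow_le_one₀ (norm_nonneg _) hq.le
        have h3 : ‖a ^ k‖ ≤ 1 := by rw [norm_pow]; exact pow_le_one₀ (norm_nonneg _) ha.le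
        have h4 : ‖hermite q (n - k) θ‖ ≤ C * ((n : ℝ) + 1) := by
          refine (hC _ _ (norm_circ θ).le (norm_circInv θ).le (n - k)).trans ?_
          gcongr
          omega
        have h5 : ‖(-1 : ℂ) ^ k‖ = 1 := by simp
        rw [norm_mul, norm_mul, norm_mul, norm_mul, h5]
        calc _ ≤ B * 1 * 1 * 1 * (C * ((n : ℝ) + 1)) := by gcongr
          _ = _ := by ring
    _ = B * C * ((n : ℝ) + 1) ^ 2 := by simp; ring

lemma hermite_change_base (hp : ‖p‖ < 1) (hq : ‖q‖ < 1) (n : ℕ) (θ : ℝ) :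
    hermite p n θ = ∑ l ∈ range (n / 2 + 1), cCoeff p q n l * hermite q (n - 2 * l) θ := by
  rw [hermite, rogersSzego_change_base hp hq]
  simp only [circ_mul_circInv, one_pow, mul_one]
  rfl

lemma rogersSzego_zero_right (hq : ‖q‖ < 1) (a : ℂ) (n : ℕ) : rogersSzego q a 0 n = a ^ n := by
  rw [rogersSzego, sum_range_succ, sum_eq_zero, qBinom_self hq]
  · simp
  · intro k hk
    rw [zero_pow (by have := mem_range.mp hk; omega), mul_zero]

/-- The series coefficient `dZero` is an integral of a big `q`-Hermite polynomial. -/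
lemma dZero_eq_hermiteFun (hp : ‖p‖ < 1) (hq : ‖q‖ < 1) (ha : ‖a‖ < 1) (n : ℕ) :
    dZero p q a n = hermiteFun q (fun θ => bigHermite p a n θ * hermiteGen q a θ) := by
  have hg := continuous_hermiteGen hq ha
  -- This is the source of the power a^m, with m = n-j-2l, in `dZero`.
  have hpow : ∀ N, hermiteFun q (fun θ => hermite q N θ * hermiteGen q a θ) = a ^ N := fun N => by
    have h := hermiteFun_hermite_mul_gen hq ha (d := 0) (by simp) N
    simpa [rogersSzego_zero_right hq] using h
  have e : (fun θ => bigHermite p a n θ * hermiteGen q a θ) =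
      fun θ => ∑ j ∈ range (n + 1), ∑ l ∈ range ((n - j) / 2 + 1),
        qBinom p n j * (-1) ^ j * p ^ j.choose 2 * a ^ j * cCoeff p q (n - j) l *
          (hermite q (n - j - 2 * l) θ * hermiteGen q a θ) := by
    funext θ
    rw [bigHermite, sum_mul]
    refine sum_congr rfl fun j _ => ?_
    rw [hermite_change_base hp hq, mul_sum, sum_mul]
    exact sum_congr rfl fun l _ => by ring
  rw [e, hermiteFun_sum hq _ fun j _ => by fun_prop]
  refine sum_congr rfl fun j _ => ?_
  rw [hermiteFun_sum hq _ fun l _ => by fun_prop]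
  refine sum_congr rfl fun l _ => ?_
  rw [hermiteFun_const_mul, hpow, dCoeff, qBinom_self hq]
  ring

end BigHermite

/-! ### Coefficients of the kernel expansion and their two recurrences. -/

section Expansion

variable {p a t : ℂ}

/-- The factor of the coefficients below that depends on `k` alone. -/
noncomputable def expandFactor (p a : ℂ) (k : ℕ) : ℂ :=
  (-1) ^ k * p ^ (k ^ 2) * a ^ k / qPoch (p ^ 2) (p ^ 2) k

/-- `1/(p;p)_{n-k}`, and zero for `k > n`. -/
noncomputable def recipPoch (p : ℂ) (n k : ℕ) : ℂ := if k ≤ n then (qPoch p p (n - k))⁻¹ else 0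

/-- The coefficient of `H_n(x;a|p²)` in the expansion of
`(at;p)_∞ (pt²;p²)_∞ / (te^{iθ}, te^{-iθ};p)_∞`. -/
noncomputable def expandCoeff (p a : ℂ) (n : ℕ) (s : ℂ) : ℂ :=
  ∑ k ∈ range (n + 1), expandFactor p a k * recipPoch p n k * s ^ (n + k)

lemma expandFactor_succ (hp : ‖p‖ < 1) (a : ℂ) (k : ℕ) :
    expandFactor p a (k + 1) * (1 - p ^ (2 * (k + 1))) =
      -(a * p ^ (2 * k + 1) * expandFactor p a k) := by
  have hp2 := norm_pow_lt_one hp two_ne_zero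
  have h1 := qPoch_ne_zero hp2 hp2 k
  have h2 : 1 - p ^ (2 * (k + 1)) ≠ 0 := one_sub_ne_zero_of_norm_lt (norm_pow_lt_one hp (by omega))
  rw [expandFactor, expandFactor, qPoch_succ, ← pow_succ' (p ^ 2), ← pow_mul,
    show (k + 1) ^ 2 = k ^ 2 + (2 * k + 1) by ring, pow_add]
  field_simp
  ring

lemma recipPoch_of_lt {n k : ℕ} (h : n < k) : recipPoch p n k = 0 := if_neg (by omega)

lemma recipPoch_succ_right (hp : ‖p‖ < 1) (n k : ℕ) :
    recipPoch p n (k + 1) = (1 - p ^ (n - k)) * recipPoch p n k := by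
  rcases lt_trichotomy n k with h | rfl | h
  · rw [recipPoch_of_lt h, recipPoch_of_lt (by omega), mul_zero]
  · rw [recipPoch_of_lt n.lt_succ_self]; simp
  · obtain ⟨m, rfl⟩ := Nat.exists_eq_add_of_lt h
    rw [recipPoch, recipPoch, if_pos (by omega), if_pos (by omega),
      show k + m + 1 - (k + 1) = m by omega, show k + m + 1 - k = m + 1 by omega, qPoch_succ,
      ← pow_succ']
    have h1 := qPoch_ne_zero hp hp m
    have h2 : 1 - p ^ (m + 1) ≠ 0 := one_sub_ne_zero_of_norm_lt (norm_pow_lt_one hp m.succ_ne_zero)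
    field_simp

lemma recipPoch_succ_succ (n k : ℕ) : recipPoch p (n + 1) (k + 1) = recipPoch p n k := by
  simp [recipPoch]

lemma expandCoeff_eq_sum (n : ℕ) (s : ℂ) :
    expandCoeff p a n s =
      ∑ k ∈ range (n + 2), expandFactor p a k * recipPoch p n k * s ^ (n + k) := by
  rw [expandCoeff, sum_range_succ _ (n + 1), recipPoch_of_lt n.lt_succ_self]
  simp

lemma mul_expandCoeff_eq_sum (x : ℕ → ℂ) (n : ℕ) (s : ℂ) :
    s * ∑ k ∈ range (n + 1), x k * s ^ (n + k) =
      ∑ k ∈ range (n + 2), (if k = 0 then 0 else x (k - 1)) * s ^ (n + k) := by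
  rw [sum_range_succ' _ (n + 1), mul_sum]
  simp only [Nat.add_sub_cancel, Nat.succ_ne_zero, if_true, if_false, zero_mul, add_zero]
  exact sum_congr rfl fun k _ => by ring

/-- The shifted coefficient `s α_{n-1}(s)`, zero for `n = 0`. -/
noncomputable def expandCoeffPred (p a : ℂ) (n : ℕ) (s : ℂ) : ℂ :=
  ∑ k ∈ range (n + 2), expandFactor p a k * recipPoch p n (k + 1) * s ^ (n + k)

lemma expandCoeffPred_zero (s : ℂ) : expandCoeffPred p a 0 s = 0 :=
  sum_eq_zero fun k _ => by rw [recipPoch_of_lt (by omega)]; ring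

lemma expandCoeffPred_succ (n : ℕ) (s : ℂ) :
    expandCoeffPred p a (n + 1) s = s * expandCoeff p a n s := by
  rw [expandCoeffPred, expandCoeff_eq_sum, sum_range_succ, recipPoch_of_lt (by omega), mul_sum]
  simp only [mul_zero, zero_mul, add_zero]
  refine sum_congr rfl fun k _ => ?_
  rw [recipPoch_succ_succ]
  ring

/-- With `expandCoeff_rec_two` this gives the coefficient form of A(s)(1 - se^{iθ})(1 - se^{-iθ}) =
A(ps)(1 - ps²)(1 - as) for A = ∑ α_n(s)H_n(·;a|p²). Here the terms in α_n and α_{n-1} are balanced.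
-/
lemma expandCoeff_rec_one (hp : ‖p‖ < 1) (n : ℕ) (s : ℂ) :
    expandCoeff p a n s - expandCoeff p a n (p * s) - expandCoeffPred p a n s =
      a * (s * ((p ^ 2) ^ n * expandCoeff p a n s - expandCoeff p a n (p * s))) := by
  have e1 : (p ^ 2) ^ n * expandCoeff p a n s - expandCoeff p a n (p * s) =
      ∑ k ∈ range (n + 1), ((p ^ 2) ^ n - p ^ (n + k)) *
        (expandFactor p a k * recipPoch p n k) * s ^ (n + k) := by
    rw [expandCoeff, expandCoeff, mul_sum, ← sum_sub_distrib]
    exact sum_congr rfl fun k _ => by rw [mul_pow]; ring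
  rw [e1, mul_expandCoeff_eq_sum, mul_sum, expandCoeff_eq_sum, expandCoeff_eq_sum,
    expandCoeffPred, ← sum_sub_distrib, ← sum_sub_distrib]
  refine sum_congr rfl fun k hk => ?_
  have hk' := mem_range.mp hk
  rw [recipPoch_succ_right hp n k, mul_pow]
  rcases k with _ | j
  · simp; ring
  rw [if_neg j.succ_ne_zero, Nat.add_sub_cancel]
  have hρ := recipPoch_succ_right hp n j
  have hγ := expandFactor_succ hp a j
  rcases (show j ≤ n by omega).eq_or_lt with rfl | hj
  · rw [recipPoch_of_lt j.lt_succ_self, ← pow_mul, two_mul]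
    ring
  · obtain ⟨m, rfl⟩ := Nat.exists_eq_add_of_lt hj
    rw [show j + m + 1 - (j + 1) = m by omega]
    rw [show j + m + 1 - j = m + 1 by omega] at hρ
    rw [← pow_mul]
    generalize recipPoch p (j + m + 1) (j + 1) = r' at *
    generalize recipPoch p (j + m + 1) j = r at *
    generalize expandFactor p a (j + 1) = g' at *
    generalize expandFactor p a j = g at *
    subst hρ
    linear_combination (s ^ (j + m + 1 + (j + 1)) * p ^ m * (1 - p ^ (m + 1)) * r) * hγ

/-- The remaining terms of that equation: those of order s² and s³ against the lowering term (1 -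
p^{2n+2})α_{n+1} of the big Hermite recurrence, after division by s. -/
lemma expandCoeff_rec_two (hp : ‖p‖ < 1) (n : ℕ) (s : ℂ) :
    s * expandCoeff p a n s + p * (s * expandCoeff p a n (p * s)) -
        a * p * (s * (s * expandCoeff p a n (p * s))) =
      (1 - (p ^ 2) ^ (n + 1)) * expandCoeff p a (n + 1) s := by
  have e1 : ∀ s, s * expandCoeff p a n s = ∑ k ∈ range (n + 2),
      expandFactor p a k * recipPoch p n k * s ^ (n + 1 + k) := fun s => by
    rw [expandCoeff_eq_sum, mul_sum]
    exact sum_congr rfl fun k _ => by ring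
  have e2 : p * (s * expandCoeff p a n (p * s)) = ∑ k ∈ range (n + 2),
      expandFactor p a k * recipPoch p n k * (p * s) ^ (n + 1 + k) := by
    rw [← e1]; ring
  have e3 : a * p * (s * (s * expandCoeff p a n (p * s))) = ∑ k ∈ range (n + 2),
      (if k = 0 then 0 else a * p ^ (n + k) *
        (expandFactor p a (k - 1) * recipPoch p n (k - 1))) * s ^ (n + 1 + k) := by
    rw [sum_range_succ', expandCoeff, mul_sum, mul_sum, mul_sum]
    simp only [Nat.add_sub_cancel, Nat.succ_ne_zero, if_true, if_false, zero_mul, add_zero]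
    exact sum_congr rfl fun k _ => by rw [mul_pow]; ring
  rw [e1, e2, e3, expandCoeff, mul_sum, ← sum_add_distrib, ← sum_sub_distrib]
  refine sum_congr rfl fun k hk => ?_
  have hk' := mem_range.mp hk
  rw [mul_pow]
  rcases k with _ | j
  · have h := recipPoch_succ_right hp (n + 1) 0
    rw [recipPoch_succ_succ, Nat.sub_zero] at h
    rw [h, if_pos rfl, ← pow_mul]
    ring
  rw [if_neg j.succ_ne_zero, Nat.add_sub_cancel, recipPoch_succ_succ]
  have hρ := recipPoch_succ_right hp n j
  have hγ := expandFactor_succ hp a j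
  obtain ⟨m, rfl⟩ := Nat.exists_eq_add_of_le (show j ≤ n by omega)
  rw [Nat.add_sub_cancel_left] at hρ
  rw [hρ, ← pow_mul]
  linear_combination (-(s ^ (j + m + 1 + (j + 1)) * p ^ m * recipPoch p (j + m) j)) * hγ

end Expansion

/-! ### Convergence of the kernel expansion and termwise integration. -/

section Series

variable {p q a t : ℂ}

lemma exists_expandCoeff_bound (hp : ‖p‖ < 1) (ha : ‖a‖ < 1) :
    ∃ C : ℝ, 1 ≤ C ∧ ∀ s : ℂ, ‖s‖ ≤ 1 → ∀ n,
      ‖expandCoeff p a n s‖ ≤ C * (((n : ℝ) + 1) * ‖s‖ ^ n) := by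
  have hp2 := norm_pow_lt_one hp two_ne_zero
  obtain ⟨B, hB1, -, hB⟩ := exists_qPoch_bound hp
  obtain ⟨D, hD1, -, hD⟩ := exists_qPoch_bound hp2
  refine ⟨D * B, one_le_mul_of_one_le_of_one_le hD1 hB1, fun s hs n => ?_⟩
  calc ‖expandCoeff p a n s‖ ≤ ∑ k ∈ range (n + 1), D * B * ‖s‖ ^ n := by
        refine norm_sum_le_of_le _ fun k hk => ?_
        have h1 : ‖expandFactor p a k‖ ≤ D := by
          rw [expandFactor, div_eq_mul_inv, norm_mul]
          refine (mul_le_of_le_one_left (norm_nonneg _) ?_).trans (hD k)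
          rw [norm_mul, norm_mul, norm_pow, norm_pow, norm_pow, norm_neg, norm_one, one_pow,
            one_mul]
          exact mul_le_one₀ (pow_le_one₀ (norm_nonneg _) hp.le) (by positivity)
            (pow_le_one₀ (norm_nonneg _) ha.le)
        have h2 : ‖recipPoch p n k‖ ≤ B := by
          rw [recipPoch, if_pos (Nat.lt_succ_iff.mp (mem_range.mp hk))]
          exact hB _
        have h3 : ‖s ^ (n + k)‖ ≤ ‖s‖ ^ n := by
          rw [norm_pow]
          exact pow_le_pow_of_le_one (norm_nonneg _) hs (Nat.le_add_right _ _)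
        rw [norm_mul, norm_mul]
        gcongr
    _ = D * B * (((n : ℝ) + 1) * ‖s‖ ^ n) := by simp; ring

lemma exists_expandCoeff_mul_bound (hp : ‖p‖ < 1) (ha : ‖a‖ < 1) :
    ∃ C : ℝ, ∀ s : ℂ, ‖s‖ ≤ 1 → ∀ n θ,
      ‖expandCoeff p a n s * bigHermite (p ^ 2) a n θ‖ ≤ C * (((n : ℝ) + 1) ^ 3 * ‖s‖ ^ n) := by
  obtain ⟨C, hC1, hC⟩ := exists_expandCoeff_bound hp ha
  obtain ⟨D, hD1, hD⟩ := exists_bigHermite_bound (norm_pow_lt_one hp two_ne_zero) ha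
  refine ⟨C * D, fun s hs n θ => ?_⟩
  rw [norm_mul]
  calc _ ≤ C * (((n : ℝ) + 1) * ‖s‖ ^ n) * (D * ((n : ℝ) + 1) ^ 2) := by
        gcongr
        exacts [hC s hs n, hD n θ]
    _ = _ := by ring

lemma tendsto_prod_expand (hp : ‖p‖ < 1) (a t : ℂ) :
    Tendsto (fun N => ∏ k ∈ range N, (1 - p * (t * p ^ k) ^ 2) * (1 - a * (t * p ^ k))) atTop
      (𝓝 (qPochInf (p * t ^ 2) (p ^ 2) * qPochInf (a * t) p)) := by
  refine ((tendsto_qPoch (norm_pow_lt_one hp two_ne_zero) (p * t ^ 2)).mul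
    (tendsto_qPoch hp (a * t))).congr fun N => ?_
  rw [prod_mul_distrib]
  congr 1
  · exact prod_congr rfl fun k _ => by rw [mul_pow, ← pow_mul, ← pow_mul]; ring
  · exact prod_congr rfl fun k _ => by ring

/-- Expansion of the kernel in continuous big `q`-Hermite polynomials with base `p²`. -/
lemma hasSum_expandCoeff (hp : ‖p‖ < 1) (ha : ‖a‖ < 1) (ht : ‖t‖ < 1) (θ : ℝ) :
    HasSum (fun n => expandCoeff p a n t * bigHermite (p ^ 2) a n θ)
      (qPochInf (a * t) p * qPochInf (p * t ^ 2) (p ^ 2) * hermiteGen p t θ) := by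
  have hp2 := norm_pow_lt_one hp two_ne_zero
  obtain ⟨C, hC⟩ := exists_expandCoeff_mul_bound hp ha
  have hsN : ∀ N : ℕ, ‖t * p ^ N‖ ≤ ‖t‖ := fun N => by
    rw [norm_mul, norm_pow]
    exact mul_le_of_le_one_right (norm_nonneg _) (pow_le_one₀ (norm_nonneg _) hp.le)
  have hbd : ∀ N n, ‖expandCoeff p a n (t * p ^ N) * bigHermite (p ^ 2) a n θ‖ ≤
      |C| * (((n : ℝ) + 1) ^ 3 * ‖t‖ ^ n) := fun N n => by
    refine (hC _ ((hsN N).trans ht.le) n θ).trans ?_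
    have := hsN N
    have := le_abs_self C
    gcongr
  have hsum := (summable_pow_succ_mul (norm_nonneg t) ht 3).mul_left |C|
  have hS : ∀ N : ℕ, Summable fun n => expandCoeff p a n (t * p ^ N) * bigHermite (p ^ 2) a n θ :=
    fun N => Summable.of_norm_bounded hsum (hbd N)
  set A : ℕ → ℂ := fun N => ∑' n, expandCoeff p a n (t * p ^ N) * bigHermite (p ^ 2) a n θ with hA
  have hlim : Tendsto A atTop (𝓝 1) := by
    have h := tendsto_tsum_of_dominated_convergence (𝓕 := atTop)
      (f := fun (N n : ℕ) => expandCoeff p a n (t * p ^ N) * bigHermite (p ^ 2) a n θ)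
      (g := fun n => if n = 0 then 1 else 0) hsum (fun n => ?_) (Eventually.of_forall hbd)
    · simpa using h
    · have h0 : Tendsto (fun N : ℕ => t * p ^ N) atTop (𝓝 (t * 0)) :=
        (tendsto_pow_atTop_nhds_zero_of_norm_lt_one hp).const_mul t
      have hc : Continuous (expandCoeff p a n) := by unfold expandCoeff; fun_prop
      have h1 := ((hc.tendsto (t * 0)).comp h0).mul_const (bigHermite (p ^ 2) a n θ)
      have h2 : expandCoeff p a n (t * 0) * bigHermite (p ^ 2) a n θ = if n = 0 then 1 else 0 := by
        rcases n with _ | n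
        · simp [expandCoeff, expandFactor, recipPoch, bigHermite_zero hp2]
        · simp [expandCoeff]
      rw [h2] at h1
      exact h1
  have hfun : ∀ N, A N * ((1 - circ θ * t * p ^ N) * (1 - circInv θ * t * p ^ N)) =
      A (N + 1) * ((1 - p * (t * p ^ N) ^ 2) * (1 - a * (t * p ^ N))) := fun N => by
    set s := t * p ^ N with hs
    set b : ℕ → ℂ := fun n => bigHermite (p ^ 2) a n θ with hb
    have h1 : HasSum (fun n => expandCoeff p a n s * b n) (A N) := (hS N).hasSum
    have h2 : HasSum (fun n => expandCoeff p a n (p * s) * b n) (A (N + 1)) := by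
      refine (hS (N + 1)).hasSum.congr_fun fun n => ?_
      rw [hs, show t * p ^ (N + 1) = p * (t * p ^ N) by ring]
    -- Summability is read off from `expandCoeff_rec_one`. The value S1 of this sum is never needed,
    -- since it cancels in `hmain`.
    have hpred : Summable fun n => expandCoeffPred p a n s * b n := by
      have e : (fun n => expandCoeffPred p a n s * b n) = fun n =>
          expandCoeff p a n s * b n - expandCoeff p a n (p * s) * b n -
            a * (s * ((p ^ 2) ^ n * (expandCoeff p a n s * b n) -
              expandCoeff p a n (p * s) * b n)) := by
        funext n
        linear_combination (-b n) * expandCoeff_rec_one hp n s (a := a)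
      have h3 : Summable fun n => (p ^ 2) ^ n * (expandCoeff p a n s * b n) := by
        refine Summable.of_norm_bounded h1.summable.norm fun n => ?_
        rw [norm_mul, norm_pow]
        exact mul_le_of_le_one_left (norm_nonneg _) (pow_le_one₀ (norm_nonneg _) hp2.le)
      rw [e]
      exact (h1.summable.sub h2.summable).sub (((h3.sub h2.summable).mul_left s).mul_left a)
    obtain ⟨S1, hS1⟩ := hpred
    have hup : HasSum (fun n => s * (expandCoeff p a n s * b (n + 1))) S1 := by
      refine ((hasSum_succ_iff (by simp [expandCoeffPred_zero])).mpr hS1).congr_fun fun n => ?_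
      rw [expandCoeffPred_succ]
      exact (mul_assoc _ _ _).symm
    have hdown : HasSum (fun n => s * (expandCoeff p a n s * ((1 - (p ^ 2) ^ n) * b (n - 1))))
        (s * (s * A N + p * (s * A (N + 1)) - a * p * (s * (s * A (N + 1))))) := by
      refine (hasSum_succ_iff (by simp)).mp
        (((((h1.mul_left s).add ((h2.mul_left s).mul_left p)).sub
          (((h2.mul_left s).mul_left s).mul_left (a * p))).mul_left s).congr_fun fun n => ?_)
      rw [Nat.add_sub_cancel]
      linear_combination (-s * b n) * expandCoeff_rec_two hp n s (a := a)
    -- Every term of this series is zero, by `expandCoeff_rec_one` and the recurrence of the big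
    -- Hermite polynomials; the vanishing of its sum is the functional equation.
    have hmain : HasSum (fun n => expandCoeff p a n s * b n - expandCoeff p a n (p * s) * b n -
        expandCoeffPred p a n s * b n - ((circ θ + circInv θ) * (s * (expandCoeff p a n s * b n)) -
          s * (expandCoeff p a n s * b (n + 1)) -
          s * (expandCoeff p a n s * ((1 - (p ^ 2) ^ n) * b (n - 1))) -
          a * (s * (expandCoeff p a n (p * s) * b n))))
        (A N - A (N + 1) - S1 - ((circ θ + circInv θ) * (s * A N) - S1 -
          s * (s * A N + p * (s * A (N + 1)) - a * p * (s * (s * A (N + 1)))) -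
          a * (s * A (N + 1)))) :=
      ((h1.sub h2).sub hS1).sub (((((h1.mul_left s).mul_left _).sub hup).sub hdown).sub
        ((h2.mul_left s).mul_left a))
    have hz := hmain.unique (hasSum_zero.congr_fun fun n => by
      have hrec := bigHermite_succ hp2 a n θ
      simp only [hb]
      linear_combination bigHermite (p ^ 2) a n θ * expandCoeff_rec_one hp n s (a := a) +
        s * expandCoeff p a n s * hrec)
    rw [mul_assoc (circ θ), mul_assoc (circInv θ), ← hs]
    linear_combination hz + s ^ 2 * A N * circ_mul_circInv θ
  have key := mul_qPochInf_eq_of_qdiff hp hlim (tendsto_prod_expand hp a t) hfun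
  have hval : A 0 = qPochInf (a * t) p * qPochInf (p * t ^ 2) (p ^ 2) * hermiteGen p t θ := by
    rw [hermiteGen, eq_mul_inv_iff_mul_eq₀ (hermiteGen_denom_ne_zero hp ht θ), key]
    ring
  rw [← hval]
  simpa [hA] using (hS 0).hasSum

lemma hTerm_eq (p q a t : ℂ) (n : ℕ) :
    hTerm p q a t n = expandCoeff p a n t * dZero (p ^ 2) (q ^ 2) a n := by
  rw [hTerm, expandCoeff]
  congr 1
  refine sum_congr rfl fun k hk => ?_
  rw [expandFactor, recipPoch, if_pos (Nat.lt_succ_iff.mp (mem_range.mp hk)), ← div_div]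
  ring

/-- The kernel expansion is multiplied by G_{q²}(a) and integrated termwise, under a majorant
independent of θ. In ℂ `HasSum` is unconditional, so absolute convergence is included. -/
lemma hasSum_hTerm (hp : ‖p‖ < 1) (hq : ‖q‖ < 1) (ha : ‖a‖ < 1) (ht : ‖t‖ < 1) :
    HasSum (hTerm p q a t) (hIntegral p q a t) := by
  have hp2 := norm_pow_lt_one hp two_ne_zero
  have hq2 := norm_pow_lt_one hq two_ne_zero
  obtain ⟨C, hC⟩ := exists_expandCoeff_mul_bound hp ha
  obtain ⟨B, hB⟩ := exists_hermiteGen_bound hq2 ha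
  have hg := continuous_hermiteGen hq2 ha
  have h := hasSum_hermiteFun hq2
    (F := fun n θ => expandCoeff p a n t * bigHermite (p ^ 2) a n θ * hermiteGen (q ^ 2) a θ)
    (fun n => by fun_prop)
    (((summable_pow_succ_mul (norm_nonneg t) ht 3).mul_left C).mul_right B)
    (fun n θ => by
      have h1 := hC t ht.le n θ
      have h2 := (norm_nonneg _).trans h1
      rw [norm_mul]
      gcongr
      exact hB θ)
    (fun θ => (hasSum_expandCoeff hp ha ht θ).mul_right _)
  simp only [mul_assoc (expandCoeff p a _ t)] at h
  simp only [hermiteFun_const_mul, ← dZero_eq_hermiteFun hp2 hq2 ha, ← hTerm_eq] at h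
  rw [hIntegral_eq, ← hermiteFun_const_mul]
  simpa only [mul_comm, mul_left_comm, mul_assoc] using h

end Series

end BigQHermite

theorem mainTheorem8 (q a t : ℂ) (hq : ‖q‖ < 1) (ha : ‖a‖ < 1) (ht : ‖t‖ < 1) :
    (∀ p : ℂ, ‖p‖ < 1 →
      HasSum (BigQHermite.hTerm p q a t) (BigQHermite.hIntegral p q a t)) ∧
    (BigQHermite.hIntegral q q a t = 1 ∧
      HasSum (BigQHermite.hTerm q q a t) 1) ∧
    (BigQHermite.hIntegral (-q) q a t = 1 ∧
      HasSum (BigQHermite.hTerm (-q) q a t) 1) ∧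
    (BigQHermite.hIntegral (q ^ 2) q a t = BigQHermite.qPochInf (q ^ 2 * t ^ 2) (q ^ 4) ∧
      HasSum (BigQHermite.hTerm (q ^ 2) q a t)
        (BigQHermite.qPochInf (q ^ 2 * t ^ 2) (q ^ 4))) ∧
    (BigQHermite.hIntegral (q ^ 2) (q ^ 3) a t =
        BigQHermite.qPochInf (a * t ^ 3 * q ^ 6) (q ^ 6) /
          BigQHermite.qPochInf (t ^ 2 * q ^ 4) (q ^ 4) ∧
      HasSum (BigQHermite.hTerm (q ^ 2) (q ^ 3) a t)
        (BigQHermite.qPochInf (a * t ^ 3 * q ^ 6) (q ^ 6) /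
          BigQHermite.qPochInf (t ^ 2 * q ^ 4) (q ^ 4))) := by
  have hq2 := BigQHermite.norm_pow_lt_one hq two_ne_zero
  have hq3 := BigQHermite.norm_pow_lt_one hq three_ne_zero
  have hneg : ‖-q‖ < 1 := by rwa [norm_neg]
  have h1 := BigQHermite.hIntegral_of_sq_eq hq (q := q) rfl ha ht
  have h2 := BigQHermite.hIntegral_of_sq_eq hneg (neg_sq q) ha ht
  have h3 := BigQHermite.hIntegral_sq hq ha ht
  have h4 := BigQHermite.hIntegral_sq_cube hq ha ht
  exact ⟨fun p hp => BigQHermite.hasSum_hTerm hp hq ha ht,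
    ⟨h1, h1 ▸ BigQHermite.hasSum_hTerm hq hq ha ht⟩,
    ⟨h2, h2 ▸ BigQHermite.hasSum_hTerm hneg hq ha ht⟩,
    ⟨h3, h3 ▸ BigQHermite.hasSum_hTerm hq2 hq ha ht⟩,
    ⟨h4, h4 ▸ BigQHermite.hasSum_hTerm hq2 hq3 ha ht⟩⟩
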